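/- Let $G=(V,E)$ be a finite simple graph with $n\ge 3$ vertices, and let every vertex $v$ have an integer cap $\ell_{\max}(v)$. Consider the following synchronous randomized algorithm in the full-duplex beeping model. The state of a vertex $v$ is a level $\ell(v)\in\{-\ell_{\max}(v),\dots,\ell_{\max}(v)\}$. In every round, independently of the other vertices and of the past, $v$ beeps with probability $\min\{2^{-\ell(v)},1\}$ if $\ell(v)<\ell_{\max}(v)$, and it does not beep if $\ell(v)=\ell_{\max}(v)$. Then all vertices update their levels simultaneously: if at least one neighbor of $v$ has beeped, then $\ell(v)\leftarrow\min\{\ell(v)+1,\ell_{\max}(v)\}$; otherwise, if $v$ itself has beeped, then $\ell(v)\leftarrow-\ell_{\max}(v)$; otherwise $\ell(v)\leftarrow\max\{\ell(v)-1,1\}$. A vertex $v$ is in the set $I$ if $\ell(v)=-\ell_{\max}(v)$ and $\ell(u)=\ell_{\max}(u)$ for every neighbor $u$ of $v$; the vertices of $I$ and their neighbors are called stable. The algorithm has stabilized to an MIS if all vertices are stable, $I$ is a maximal independent set of $G$, and $I$ remains the same in all later rounds, whatever the random choices are. Theorem. For all real constants $c_1\ge 30$, $c_2>0$ and $a>0$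 there is a constant $C>0$, depending only on $c_1,c_2,a$, such that the following holds for every $n\ge 3$ and every $n$-vertex graph $G$. If $$2\log_2\deg(v)+c_1\;\le\;\ell_{\max}(v)\;\le\; c_2\log_2 n\qquad\text{for every vertex } v$$ (where $\log_2 0$ is read as $0$, so that the cap of an isolated vertex is at least $c_1$), then, from any initial configuration of levels and for every integer $T\ge C\log_2 n\cdot\log_2\log_2 n$, the algorithm has stabilized to an MIS after $T$ rounds with probability at least $1-n^{-a}$. That is, it stabilizes to an MIS from any configuration within $O(\log n\cdot\log\log n)$ rounds with high probability. -/

import Mathlib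

open scoped NNReal ENNReal

namespace BeepingMIS

noncomputable section

/-- A configuration: the current level `ℓ(v)` of every vertex `v`. -/
abbrev Config (V : Type*) := V → ℤ

/-- The configurations of the algorithm: the level of `v` lies in `{-ℓmax(v), …, ℓmax(v)}`. -/
def IsConfig {V : Type*} (lmax : V → ℕ) (c : Config V) : Prop :=
  ∀ v, -(lmax v : ℤ) ≤ c v ∧ c v ≤ (lmax v : ℤ)

/-- The probability that a vertex with cap `m` and level `l` beeps:
`min {2^(-l), 1}` if `l < m`, and `0` otherwise. -/
def beepProb (m : ℕ) (l : ℤ) : ℝ≥0 :=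
  if l < (m : ℤ) then min ((2 : ℝ≥0) ^ (-l)) 1 else 0

theorem beepProb_le_one (m : ℕ) (l : ℤ) : beepProb m l ≤ 1 := by
  unfold beepProb
  split_ifs
  · exact min_le_right _ _
  · exact zero_le_one

/-- The law of the beeps of one round (`b v = true` iff `v` beeps) from the configuration `c`:
the vertices decide independently, and `v` beeps with probability `beepProb (lmax v) (c v)`. -/
def beepLaw {V : Type*} [Fintype V] (lmax : V → ℕ) (c : Config V) : PMF (V → Bool) := by
  classical
  exact PMF.ofFintype
    (fun b => ∏ v, ((if b v = true then beepProb (lmax v) (c v)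
      else 1 - beepProb (lmax v) (c v) : ℝ≥0) : ℝ≥0∞))
    (by
      rw [← Fintype.prod_sum fun v x => ((if x = true then beepProb (lmax v) (c v)
        else 1 - beepProb (lmax v) (c v) : ℝ≥0) : ℝ≥0∞)]
      refine Finset.prod_eq_one fun v _ => ?_
      rw [Fintype.sum_bool]
      simp only [if_true, Bool.false_eq_true, if_false]
      rw [← ENNReal.coe_add, add_tsub_cancel_of_le (beepProb_le_one _ _), ENNReal.coe_one])

open Classical in
/-- The update of the levels at the end of a round in which exactly the vertices `v` with
`b v = true` have beeped. A vertex receives a signal iff one of its neighbors beeps. -/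
def update {V : Type*} (G : SimpleGraph V) (lmax : V → ℕ) (c : Config V) (b : V → Bool) :
    Config V := fun v =>
  if ∃ u, G.Adj v u ∧ b u = true then min (c v + 1) (lmax v : ℤ)
  else if b v = true then -(lmax v : ℤ)
  else max (c v - 1) 1

/-- One round of the algorithm: the law of the next configuration. -/
def round {V : Type*} [Fintype V] (G : SimpleGraph V) (lmax : V → ℕ) (c : Config V) :
    PMF (Config V) :=
  (beepLaw lmax c).map (update G lmax c)

/-- The law of the configuration after `t` rounds of the algorithm, started from `c`
(each round uses fresh randomness). -/
def law {V : Type*} [Fintype V] (G : SimpleGraph V) (lmax : V → ℕ) (c : Config V) :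
    ℕ → PMF (Config V)
  | 0 => PMF.pure c
  | t + 1 => (law G lmax c t).bind (round G lmax)

/-- The set `I` of the vertices that have joined the MIS: the level of `v` is `-ℓmax(v)`, and the
level of every neighbor `u` of `v` is `ℓmax(u)`. -/
def misSet {V : Type*} (G : SimpleGraph V) (lmax : V → ℕ) (c : Config V) : Set V :=
  {v | c v = -(lmax v : ℤ) ∧ ∀ u, G.Adj v u → c u = (lmax u : ℤ)}

/-- The set `S = I ∪ N(I)` of the stable vertices. -/
def stableSet {V : Type*} (G : SimpleGraph V) (lmax : V → ℕ) (c : Config V) : Set V :=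
  misSet G lmax c ∪ {w | ∃ v ∈ misSet G lmax c, G.Adj v w}

/-- The algorithm has stabilized to an MIS in the configuration `c`: all vertices are stable, the
vertices that have joined the MIS form a maximal independent set of `G`, and this set never changes
again, whatever the random choices in later rounds are. -/
def StabilizedToMIS {V : Type*} [Fintype V] (G : SimpleGraph V) (lmax : V → ℕ)
    (c : Config V) : Prop :=
  stableSet G lmax c = Set.univ ∧
  Maximal G.IsIndepSet (misSet G lmax c) ∧
  ∀ t : ℕ, ∀ c' ∈ (law G lmax c t).support, misSet G lmax c' = misSet G lmax c

end

end BeepingMIS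

/-!
A vertex of level at most `0` beeps surely. Adjacent vertices that both do so raise each other's
level in every round, so there are none after `max lmax + 1` rounds.

Assign to a vertex its beeping probability as weight or, if it beeps surely, a bound on the
probability that a neighbor interrupts it before it joins the MIS. The cap `2 log₂ deg + 30` makes
this bound at most `1 / 1000` for a vertex that has just beeped alone, and it shrinks geometrically
in expectation afterwards. For every vertex `v`, either the best such bound in its closed
neighborhood shrinks in expectation in a round, or the total weight of its neighbors, scaled by a
power of the level of `v`, does, while the other quantity grows by a bounded factor. By Hölder's
inequality a suitable weighted geometric mean of the two decays exponentially, so that `O(log n)`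
rounds and a union bound settle all vertices `v`, provided that the probability that neighbors of
`v` leave their caps is small.

Those probabilities are at most `2 ^ (-30) / deg ^ 2` per neighbor and vanish for settled neighbors.
Once all vertices of degree below `s` are settled, they are therefore negligible around the vertices
of degree below `2 * s ^ 2`. This squares the degree threshold every `O(log n)` rounds, and
`O(log log n)` such phases exhaust the graph.
-/

namespace BeepingMIS

section Bernoulli

/-- The probability of the outcome `b` of independent Bernoulli trials with success
probabilities `p`. -/
noncomputable def bernWeight {V : Type*} [Fintype V] (p : V → ℝ) (b : V → Bool) : ℝ :=
  ∏ v, if b v = true then p v else 1 - p v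

open Classical in
/-- The expectation of `f` under independent Bernoulli trials with success probabilities `p`. It is
a finite sum of reals, which spares the analysis of a single round all integrability questions. -/
noncomputable def bernExp {V : Type*} [Fintype V] (p : V → ℝ) (f : (V → Bool) → ℝ) : ℝ :=
  ∑ b, bernWeight p b * f b

open Classical in
/-- The probability of the event `P` under independent Bernoulli trials with success
probabilities `p`. -/
noncomputable def bernProb {V : Type*} [Fintype V] (p : V → ℝ) (P : (V → Bool) → Prop) : ℝ :=
  bernExp p fun b => if P b then 1 else 0

theorem prod_one_sub_le_exp {ι : Type*} {s : Finset ι} {p : ι → ℝ} (hp : ∀ i ∈ s, p i ≤ 1) :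
    ∏ i ∈ s, (1 - p i) ≤ Real.exp (-∑ i ∈ s, p i) := by
  rw [← Finset.sum_neg_distrib, Real.exp_sum]
  exact Finset.prod_le_prod (fun i hi => sub_nonneg.2 (hp i hi))
    fun i _ => Real.one_sub_le_exp_neg _

theorem exp_neg_two_mul_le_one_sub {x : ℝ} (h0 : 0 ≤ x) (h1 : x ≤ 1 / 2) :
    Real.exp (-(2 * x)) ≤ 1 - x := by
  rw [Real.exp_neg, inv_le_iff_one_le_mul₀ (Real.exp_pos _)]
  have := Real.add_one_le_exp (2 * x)
  nlinarith

theorem exp_le_prod_one_sub {ι : Type*} {s : Finset ι} {p : ι → ℝ} (h0 : ∀ i ∈ s, 0 ≤ p i)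
    (h1 : ∀ i ∈ s, p i ≤ 1 / 2) : Real.exp (-(2 * ∑ i ∈ s, p i)) ≤ ∏ i ∈ s, (1 - p i) := by
  rw [Finset.mul_sum, ← Finset.sum_neg_distrib, Real.exp_sum]
  exact Finset.prod_le_prod (fun i _ => (Real.exp_pos _).le)
    fun i hi => exp_neg_two_mul_le_one_sub (h0 i hi) (h1 i hi)

variable {V : Type*} [Fintype V] {p : V → ℝ}

theorem bernExp_add (f g : (V → Bool) → ℝ) :
    bernExp p (fun b => f b + g b) = bernExp p f + bernExp p g := by
  simp only [bernExp, mul_add, Finset.sum_add_distrib]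

theorem bernExp_const_mul (k : ℝ) (f : (V → Bool) → ℝ) :
    bernExp p (fun b => k * f b) = k * bernExp p f := by
  simp only [bernExp, Finset.mul_sum, mul_left_comm]

theorem bernExp_sum {ι : Type*} (s : Finset ι) (f : ι → (V → Bool) → ℝ) :
    bernExp p (fun b => ∑ i ∈ s, f i b) = ∑ i ∈ s, bernExp p (f i) := by
  simp only [bernExp, Finset.mul_sum]
  exact Finset.sum_comm

theorem bernExp_prod (h : V → Bool → ℝ) :
    bernExp p (fun b => ∏ v, h v (b v)) = ∏ v, (p v * h v true + (1 - p v) * h v false) := by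
  classical
  simp only [bernExp, bernWeight, ← Finset.prod_mul_distrib]
  convert! (Fintype.prod_sum fun v x => (if x = true then p v else 1 - p v) * h v x).symm using 2
  simp

theorem bernExp_const (k : ℝ) : bernExp p (fun _ => k) = k := by
  have hone : bernExp p (fun _ => 1) = 1 := by
    simpa using bernExp_prod (p := p) fun _ _ => 1
  simpa [hone] using bernExp_const_mul (p := p) k fun _ => 1

theorem bernExp_ite (P : (V → Bool) → Prop) [DecidablePred P] :
    bernExp p (fun b => if P b then 1 else 0) = bernProb p P := by
  rw [bernProb]
  congr!

theorem bernProb_silent (s : Finset V) :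
    bernProb p (fun b => ∀ x ∈ s, b x = false) = ∏ x ∈ s, (1 - p x) := by
  classical
  have hprod := bernExp_prod (p := p) fun v x => if v ∈ s → x = false then 1 else 0
  simp only [Finset.prod_ite_zero, Finset.prod_const_one, Finset.mem_univ, true_imp_iff] at hprod
  calc bernProb p (fun b => ∀ x ∈ s, b x = false)
      = bernExp p (fun b => if ∀ x ∈ s, b x = false then 1 else 0) := by
        rw [bernExp_ite]
    _ = ∏ v, if v ∈ s then 1 - p v else 1 := by
        rw [hprod]
        exact Finset.prod_congr rfl fun v _ => by by_cases hv : v ∈ s <;> simp [hv]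
    _ = ∏ x ∈ s, (1 - p x) := by rw [Finset.prod_ite_mem, Finset.univ_inter]

theorem bernProb_eq_add_of_iff_or {P Q R : (V → Bool) → Prop} (hdisj : ∀ b, Q b → ¬ R b)
    (hP : ∀ b, P b ↔ Q b ∨ R b) : bernProb p P = bernProb p Q + bernProb p R := by
  classical
  simp only [← bernExp_ite, ← bernExp_add]
  congr 1
  funext b
  by_cases hQ : Q b
  · simp [hP, hQ, hdisj b hQ]
  · simp [hP, hQ]

theorem bernProb_beep_silent {u : V} {s : Finset V} (hu : u ∉ s) :
    bernProb p (fun b => b u = true ∧ ∀ x ∈ s, b x = false) = p u * ∏ x ∈ s, (1 - p x) := by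
  classical
  have hsplit := bernProb_eq_add_of_iff_or (p := p)
    (P := fun b => ∀ x ∈ s, b x = false) (Q := fun b => b u = true ∧ ∀ x ∈ s, b x = false)
    (R := fun b => ∀ x ∈ insert u s, b x = false) (fun b hQ hR => by simp_all)
    fun b => by cases hbu : b u <;> simp [hbu]
  rw [bernProb_silent, bernProb_silent, Finset.prod_insert hu] at hsplit
  linarith

theorem bernProb_beep (u : V) : bernProb p (fun b => b u = true) = p u := by
  simpa using bernProb_beep_silent (p := p) (Finset.notMem_empty u)

variable (hp : ∀ v, p v ∈ Set.Icc 0 1)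
include hp

theorem bernWeight_nonneg (b : V → Bool) : 0 ≤ bernWeight p b :=
  Finset.prod_nonneg fun v _ => by
    split_ifs
    · exact (hp v).1
    · exact sub_nonneg.2 (hp v).2

theorem bernExp_mono {f g : (V → Bool) → ℝ} (h : ∀ b, bernWeight p b ≠ 0 → f b ≤ g b) :
    bernExp p f ≤ bernExp p g := by
  refine Finset.sum_le_sum fun b _ => ?_
  by_cases hb : bernWeight p b = 0
  · simp [hb]
  · exact mul_le_mul_of_nonneg_left (h b hb) (bernWeight_nonneg hp b)

theorem bernExp_nonneg {f : (V → Bool) → ℝ} (h : ∀ b, 0 ≤ f b) : 0 ≤ bernExp p f :=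
  Finset.sum_nonneg fun b _ => mul_nonneg (bernWeight_nonneg hp b) (h b)

theorem bernProb_nonneg (P : (V → Bool) → Prop) : 0 ≤ bernProb p P :=
  bernExp_nonneg hp fun b => by split_ifs <;> norm_num

theorem bernProb_mono {P Q : (V → Bool) → Prop} (h : ∀ b, P b → Q b) :
    bernProb p P ≤ bernProb p Q :=
  bernExp_mono hp fun b _ => by
    by_cases hP : P b
    · simp [hP, h b hP]
    · by_cases hQ : Q b <;> simp [hP, hQ]

theorem bernProb_exists_beep_le (s : Finset V) :
    bernProb p (fun b => ∃ x ∈ s, b x = true) ≤ ∑ x ∈ s, p x := by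
  classical
  calc bernProb p (fun b => ∃ x ∈ s, b x = true)
      ≤ bernExp p (fun b => ∑ x ∈ s, if b x = true then 1 else 0) :=
        bernExp_mono hp fun b _ => by
          split_ifs with hb
          · obtain ⟨x, hx, hbx⟩ := hb
            exact le_trans (by simp [hbx]) (Finset.single_le_sum
              (f := fun x => if b x = true then (1 : ℝ) else 0) (fun _ _ => by positivity) hx)
          · simp
    _ = ∑ x ∈ s, bernProb p (fun b => b x = true) := by
        simp only [bernExp_sum, bernExp_ite]
    _ = ∑ x ∈ s, p x := Finset.sum_congr rfl fun x _ => bernProb_beep x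

theorem le_bernProb_exists_lonely {N : V → Finset V} (hN : ∀ u, u ∉ N u) {k : ℝ} (s : Finset V)
    (hk : ∀ u ∈ s, k ≤ ∏ x ∈ N u, (1 - p x)) :
    k * (1 - ∏ x ∈ s, (1 - p x)) ≤
      bernProb p fun b => ∃ u ∈ s, b u = true ∧ ∀ x ∈ N u, b x = false := by
  classical
  have hq : ∀ s : Finset V, 0 ≤ ∏ x ∈ s, (1 - p x) :=
    fun s => Finset.prod_nonneg fun x _ => sub_nonneg.2 (hp x).2
  induction s using Finset.induction_on with
  | empty => simpa using bernProb_nonneg hp _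
  | insert u s hu ih =>
    have hunion : (∏ x ∈ s, (1 - p x)) * (∏ x ∈ N u, (1 - p x)) ≤ ∏ x ∈ s ∪ N u, (1 - p x) := by
      rw [← Finset.prod_union_inter]
      exact mul_le_of_le_one_right (hq _) (Finset.prod_le_one
        (fun x _ => sub_nonneg.2 (hp x).2) fun x _ => sub_le_self _ (hp x).1)
    -- If `u` beeps while all of `s` is silent, then `u` is the only candidate: disjoint events.
    have hsplit : bernProb p (fun b => ∃ w ∈ s, b w = true ∧ ∀ x ∈ N w, b x = false)
        + bernProb p (fun b => b u = true ∧ ∀ x ∈ s ∪ N u, b x = false)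
        ≤ bernProb p fun b => ∃ w ∈ insert u s, b w = true ∧ ∀ x ∈ N w, b x = false := by
      rw [← bernProb_eq_add_of_iff_or (fun b hs hu => ?_) fun b => Iff.rfl]
      · refine bernProb_mono hp fun b hb => ?_
        rcases hb with ⟨w, hw, hbw⟩ | ⟨hbu, hsilent⟩
        · exact ⟨w, Finset.mem_insert_of_mem hw, hbw⟩
        · exact ⟨u, Finset.mem_insert_self u s, hbu,
            fun x hx => hsilent x (Finset.mem_union_right _ hx)⟩
      · obtain ⟨w, hw, hbw, -⟩ := hs
        simp [hu.2 w (Finset.mem_union_left _ hw)] at hbw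
    have hgain : p u * ((∏ x ∈ s, (1 - p x)) * k) ≤ p u * ∏ x ∈ s ∪ N u, (1 - p x) :=
      mul_le_mul_of_nonneg_left ((mul_le_mul_of_nonneg_left (hk u (Finset.mem_insert_self u s))
        (hq s)).trans hunion) (hp u).1
    rw [bernProb_beep_silent (by simp [hu, hN u])] at hsplit
    rw [Finset.prod_insert hu]
    linarith [ih fun x hx => hk x (Finset.mem_insert_of_mem hx)]

theorem bernExp_rpow_mul_rpow_le {f g : (V → Bool) → ℝ} (hf : ∀ b, 0 ≤ f b) (hg : ∀ b, 0 ≤ g b)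
    {e : ℝ} (he0 : 0 < e) (he1 : e < 1) :
    bernExp p (fun b => f b ^ e * g b ^ (1 - e)) ≤ bernExp p f ^ e * bernExp p g ^ (1 - e) := by
  classical
  have hw := bernWeight_nonneg hp
  have hcancel : ∀ {x r : ℝ}, 0 ≤ x → 0 < r → (x ^ r) ^ r⁻¹ = x := fun hx hr => by
    rw [← Real.rpow_mul hx, mul_inv_cancel₀ hr.ne', Real.rpow_one]
  have hholder := Real.inner_le_Lp_mul_Lq_of_nonneg Finset.univ
    (f := fun b => (bernWeight p b * f b) ^ e) (g := fun b => (bernWeight p b * g b) ^ (1 - e))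
    (Real.HolderConjugate.inv_one_sub_inv he0 he1)
    (fun b _ => Real.rpow_nonneg (mul_nonneg (hw b) (hf b)) _)
    (fun b _ => Real.rpow_nonneg (mul_nonneg (hw b) (hg b)) _)
  simp only [one_div, inv_inv, hcancel (mul_nonneg (hw _) (hf _)) he0,
    hcancel (mul_nonneg (hw _) (hg _)) (sub_pos.2 he1)] at hholder
  refine le_trans (le_of_eq (Finset.sum_congr rfl fun b _ => ?_)) hholder
  rw [Real.mul_rpow (hw b) (hf b), Real.mul_rpow (hw b) (hg b), mul_mul_mul_comm,
    ← Real.rpow_add' (hw b) (by norm_num), add_sub_cancel, Real.rpow_one]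

end Bernoulli

section Rate

/-- The probability `beepProb m l` that a vertex with cap `m` and level `l` beeps, as a real
number. -/
noncomputable def rate (m : ℕ) (l : ℤ) : ℝ := (beepProb m l : ℝ)

theorem rate_nonneg (m : ℕ) (l : ℤ) : 0 ≤ rate m l := NNReal.coe_nonneg _

theorem rate_le_one (m : ℕ) (l : ℤ) : rate m l ≤ 1 := by
  have := beepProb_le_one m l
  exact_mod_cast this

theorem rate_of_le {m : ℕ} {l : ℤ} (h : (m : ℤ) ≤ l) : rate m l = 0 := by
  simp [rate, beepProb, not_lt.2 h]

theorem rate_of_nonpos {m : ℕ} {l : ℤ} (hm : 0 < m) (h : l ≤ 0) : rate m l = 1 := by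
  have h1 : l < (m : ℤ) := by omega
  have h2 : (1 : ℝ) ≤ 2 ^ (-l) := one_le_zpow₀ (by norm_num) (by omega)
  simp only [rate, beepProb, if_pos h1]
  push_cast
  exact min_eq_right h2

theorem rate_of_nonneg {m : ℕ} {l : ℤ} (h0 : 0 ≤ l) (h : l < m) : rate m l = 2 ^ (-l) := by
  have h2 : (2 : ℝ) ^ (-l) ≤ 1 := zpow_le_one_of_nonpos₀ (by norm_num) (by omega)
  simp only [rate, beepProb, if_pos h]
  push_cast
  exact min_eq_left h2

theorem rate_le_half {m : ℕ} {l : ℤ} (h : 1 ≤ l) : rate m l ≤ 1 / 2 := by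
  rcases le_or_gt (m : ℤ) l with h1 | h1
  · rw [rate_of_le h1]; norm_num
  · rw [rate_of_nonneg (by omega) h1]
    calc (2 : ℝ) ^ (-l) ≤ 2 ^ (-1 : ℤ) := zpow_le_zpow_right₀ (by norm_num) (by omega)
      _ = 1 / 2 := by norm_num

theorem rate_min_add_one_le {m : ℕ} {l : ℤ} (h : 0 ≤ l) :
    rate m (min (l + 1) m) ≤ rate m l / 2 := by
  rcases le_or_gt (m : ℤ) (l + 1) with h1 | h1
  · rw [min_eq_right h1, rate_of_le le_rfl]
    have := rate_nonneg m l
    linarith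
  · rw [min_eq_left h1.le, rate_of_nonneg (by omega) h1, rate_of_nonneg (by omega) (by omega)]
    rw [neg_add, zpow_add₀ (by norm_num)]
    norm_num
    linarith

theorem rate_max_sub_one_le {m : ℕ} {l : ℤ} (h : 1 ≤ l) (hm : l < m) :
    rate m (max (l - 1) 1) ≤ 2 * rate m l := by
  rcases le_or_gt l 1 with h1 | h1
  · have : l = 1 := by omega
    subst this
    have := rate_nonneg m 1
    norm_num
    linarith
  · rw [max_eq_left (by omega), rate_of_nonneg (by omega) (by omega), rate_of_nonneg (by omega) hm]
    rw [neg_sub, sub_eq_add_neg, zpow_add₀ (by norm_num)]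
    norm_num

theorem rate_max_cap_sub_one {m : ℕ} (hm : 2 ≤ m) :
    rate m (max ((m : ℤ) - 1) 1) = 2 * 2 ^ (-(m : ℤ)) := by
  rw [max_eq_left (by omega), rate_of_nonneg (by omega) (by omega), neg_sub, sub_eq_add_neg,
    zpow_add₀ (by norm_num)]
  norm_num

theorem le_rate_of_lt {m L : ℕ} {l : ℤ} (h : l < m) (hL : m ≤ L) (hm : 0 < m) :
    ((2 : ℝ) ^ L)⁻¹ ≤ rate m l := by
  rcases le_or_gt l 0 with h1 | h1
  · rw [rate_of_nonpos hm h1]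
    exact inv_le_one_of_one_le₀ (one_le_pow₀ (by norm_num))
  · rw [rate_of_nonneg h1.le h, ← zpow_natCast, ← zpow_neg]
    exact zpow_le_zpow_right₀ (by norm_num) (by omega)

end Rate

section Dynamics

variable {V : Type*}

/-- The vector of beeping probabilities of a configuration. -/
noncomputable def rates (lmax : V → ℕ) (c : Config V) (v : V) : ℝ := rate (lmax v) (c v)

/-- Some neighbor of `v` beeps. -/
def Hears (G : SimpleGraph V) (b : V → Bool) (v : V) : Prop := ∃ u, G.Adj v u ∧ b u = true

/-- The beeps `b` have positive probability in the configuration `c`, as far as the vertices that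
beep surely and the vertices that surely do not beep are concerned. -/
def Legal (lmax : V → ℕ) (c : Config V) (b : V → Bool) : Prop :=
  ∀ v, (c v ≤ 0 → b v = true) ∧ ((lmax v : ℤ) ≤ c v → b v = false)

/-- The configurations in which no two adjacent vertices beep surely. -/
structure IsRegular (G : SimpleGraph V) (lmax : V → ℕ) (c : Config V) : Prop where
  isConfig : IsConfig lmax c
  one_le_of_adj : ∀ u x, G.Adj u x → c u ≤ 0 → 1 ≤ c x

variable {G : SimpleGraph V} {lmax : V → ℕ} {c : Config V} {b : V → Bool}

theorem rates_mem_Icc (v : V) : rates lmax c v ∈ Set.Icc 0 1 :=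
  ⟨rate_nonneg _ _, rate_le_one _ _⟩

theorem rates_nonneg (lmax : V → ℕ) (c : Config V) (v : V) : 0 ≤ rates lmax c v :=
  rate_nonneg _ _

theorem update_of_hears {v : V} (h : Hears G b v) :
    update G lmax c b v = min (c v + 1) (lmax v : ℤ) := if_pos h

theorem update_of_lonely {v : V} (h : ¬ Hears G b v) (hv : b v = true) :
    update G lmax c b v = -(lmax v : ℤ) :=
  (if_neg h).trans (if_pos hv)

theorem update_of_silent {v : V} (h : ¬ Hears G b v) (hv : ¬ b v = true) :
    update G lmax c b v = max (c v - 1) 1 :=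
  (if_neg h).trans (if_neg hv)

theorem update_nonpos_of_lonely {u : V} (h : ¬ Hears G b u) (hu : b u = true) :
    update G lmax c b u ≤ 0 := by
  rw [update_of_lonely h hu]
  omega

theorem update_nonpos_of_hears {u : V} (hu : c u < 0) (h : Hears G b u) :
    update G lmax c b u ≤ 0 := by
  rw [update_of_hears h]
  omega

theorem one_le_of_not_hears (hb : Legal lmax c b) {u x : V} (h : ¬ Hears G b u)
    (hx : G.Adj u x) : 1 ≤ c x := by
  by_contra hlt
  exact h ⟨x, hx, (hb x).1 (by omega)⟩

theorem IsConfig.update (hm : ∀ v, 0 < lmax v) (hc : IsConfig lmax c) :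
    IsConfig lmax (update G lmax c b) := by
  intro v
  have hcv := hc v
  have hmv := hm v
  by_cases h : Hears G b v
  · rw [update_of_hears h]; omega
  · by_cases hv : b v = true
    · rw [update_of_lonely h hv]; omega
    · rw [update_of_silent h hv]; omega

theorem IsRegular.update (hm : ∀ v, 1 < lmax v) (hc : IsRegular G lmax c)
    (hb : Legal lmax c b) : IsRegular G lmax (update G lmax c b) := by
  refine ⟨hc.isConfig.update fun v => (hm v).le, fun u x hux hu => ?_⟩
  have hmu := hm u
  have hmx := hm x
  by_cases h : Hears G b u
  · rw [update_of_hears h] at hu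
    have hcu : c u ≤ 0 := by omega
    have hcx := hc.one_le_of_adj u x hux hcu
    rw [update_of_hears ⟨u, hux.symm, (hb u).1 hcu⟩]
    omega
  · by_cases hbu : b u = true
    · have hcx := one_le_of_not_hears hb h hux
      rw [update_of_hears ⟨u, hux.symm, hbu⟩]
      omega
    · rw [update_of_silent h hbu] at hu
      omega

theorem rates_update_le_half {x : V} (h : Hears G b x) (hx : 0 ≤ c x) :
    rates lmax (update G lmax c b) x ≤ rates lmax c x / 2 := by
  rw [rates, update_of_hears h]
  exact rate_min_add_one_le hx

variable [Fintype V]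

/-- The expectation of `f` after one round from the configuration `c`. -/
noncomputable def roundExp (G : SimpleGraph V) (lmax : V → ℕ) (c : Config V)
    (f : Config V → ℝ) : ℝ :=
  bernExp (rates lmax c) fun b => f (update G lmax c b)

theorem legal_of_bernWeight_ne_zero (hm : ∀ v, 0 < lmax v)
    (h : bernWeight (rates lmax c) b ≠ 0) : Legal lmax c b := by
  rw [bernWeight, Finset.prod_ne_zero_iff] at h
  refine fun v => ⟨fun hv => ?_, fun hv => ?_⟩ <;> have h := h v (Finset.mem_univ v) <;>
    by_contra hb
  · rw [if_neg hb, rates, rate_of_nonpos (hm v) hv] at h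
    exact h (sub_self 1)
  · rw [if_pos (by simpa using hb), rates, rate_of_le hv] at h
    exact h rfl

theorem roundExp_le_bernExp (hm : ∀ v, 0 < lmax v) {f : Config V → ℝ} {g : (V → Bool) → ℝ}
    (h : ∀ b, Legal lmax c b → f (update G lmax c b) ≤ g b) :
    roundExp G lmax c f ≤ bernExp (rates lmax c) g :=
  bernExp_mono rates_mem_Icc fun b hb => h b (legal_of_bernWeight_ne_zero hm hb)

theorem roundExp_le (hm : ∀ v, 0 < lmax v) {f : Config V → ℝ} {k : ℝ}
    (h : ∀ b, Legal lmax c b → f (update G lmax c b) ≤ k) : roundExp G lmax c f ≤ k :=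
  (roundExp_le_bernExp hm h).trans_eq (bernExp_const k)

theorem roundExp_mono {f g : Config V → ℝ} (h : ∀ c', f c' ≤ g c') :
    roundExp G lmax c f ≤ roundExp G lmax c g :=
  bernExp_mono rates_mem_Icc fun _ _ => h _

end Dynamics

section Weight

variable {V : Type*} [Fintype V] (G : SimpleGraph V) [DecidableRel G.Adj] (lmax : V → ℕ)
  (c : Config V)

/-- The sum of the beeping probabilities of the neighbors of `u`. -/
noncomputable def nbrRate (u : V) : ℝ := ∑ x ∈ G.neighborFinset u, rates lmax c x

/-- The probability that no neighbor of `u` beeps. -/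
noncomputable def silenceProb (u : V) : ℝ := ∏ x ∈ G.neighborFinset u, (1 - rates lmax c x)

/-- The lower bound `2 log₂ deg + 30` on the caps, freed of logarithms. The first conjunct takes
care of isolated vertices. -/
def LargeCaps : Prop := ∀ v, 30 ≤ lmax v ∧ (G.degree v : ℝ) ^ 2 * 2 ^ 30 ≤ 2 ^ lmax v

/-- The weight of a vertex: its beeping probability or, if it beeps surely, a bound on the
probability that a neighbor beeps with it before it would have joined the MIS. The ratio `3 / 2`
lies strictly between `1` and `2`, so that the weight shrinks geometrically while the level rises
and the beeping probabilities of the neighbors are halved. -/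
noncomputable def weight (u : V) : ℝ :=
  if c u ≤ 0 then 4 * nbrRate G lmax c u * (3 / 2 : ℝ) ^ c u else rates lmax c u

/-- A bound on the probability that `u` will not join the MIS before its level becomes positive. -/
noncomputable def joinFailure (u : V) : ℝ := if c u ≤ 0 then weight G lmax c u else 1

theorem nbrRate_nonneg (u : V) : 0 ≤ nbrRate G lmax c u :=
  Finset.sum_nonneg fun _ _ => rates_nonneg _ _ _

theorem weight_nonneg (u : V) : 0 ≤ weight G lmax c u := by
  unfold weight
  split_ifs
  · have := nbrRate_nonneg G lmax c u
    positivity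
  · exact rates_nonneg lmax c u

variable {G lmax c} {b : V → Bool} {u : V}

theorem weight_of_nonpos (hu : c u ≤ 0) :
    weight G lmax c u = 4 * nbrRate G lmax c u * (3 / 2 : ℝ) ^ c u := if_pos hu

theorem weight_of_pos (hu : 1 ≤ c u) : weight G lmax c u = rates lmax c u := if_neg (by omega)

theorem joinFailure_of_nonpos (hu : c u ≤ 0) : joinFailure G lmax c u = weight G lmax c u :=
  if_pos hu

theorem joinFailure_of_pos (hu : 1 ≤ c u) : joinFailure G lmax c u = 1 := if_neg (by omega)

theorem weight_le_joinFailure (u : V) : weight G lmax c u ≤ joinFailure G lmax c u := by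
  unfold joinFailure
  split_ifs with hu
  · exact le_rfl
  · exact (weight_of_pos (by omega)).trans_le (rates_mem_Icc u).2

theorem silenceProb_le_one : silenceProb G lmax c u ≤ 1 :=
  Finset.prod_le_one (fun _ _ => sub_nonneg.2 (rates_mem_Icc _).2)
    fun _ _ => sub_le_self _ (rates_nonneg _ _ _)

theorem bernProb_hears_le (u : V) :
    bernProb (rates lmax c) (fun b => Hears G b u) ≤ nbrRate G lmax c u := by
  simpa only [Hears, SimpleGraph.mem_neighborFinset, nbrRate] using
    bernProb_exists_beep_le rates_mem_Icc (G.neighborFinset u)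

theorem not_hears_iff : ¬ Hears G b u ↔ ∀ x ∈ G.neighborFinset u, b x = false := by
  simp [Hears]

theorem bernProb_not_hears (u : V) :
    bernProb (rates lmax c) (fun b => ¬ Hears G b u) = silenceProb G lmax c u := by
  simpa only [not_hears_iff, silenceProb] using bernProb_silent (G.neighborFinset u)

theorem nbrRate_update_le_half (hu : b u = true) (h : ∀ x, G.Adj u x → 1 ≤ c x) :
    nbrRate G lmax (update G lmax c b) u ≤ nbrRate G lmax c u / 2 := by
  rw [nbrRate, nbrRate, Finset.sum_div]
  refine Finset.sum_le_sum fun x hx => ?_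
  rw [SimpleGraph.mem_neighborFinset] at hx
  exact rates_update_le_half ⟨u, hx.symm, hu⟩ (zero_le_one.trans (h x hx))

theorem nbrRate_le_degree_div_two (h : ∀ x, G.Adj u x → 1 ≤ c x) :
    nbrRate G lmax c u ≤ G.degree u * (1 / 2) := by
  rw [← SimpleGraph.card_neighborFinset_eq_degree, ← nsmul_eq_mul]
  refine Finset.sum_le_card_nsmul _ _ _ fun x hx => ?_
  rw [SimpleGraph.mem_neighborFinset] at hx
  exact rate_le_half (h x hx)

theorem LargeCaps.one_lt (hL : LargeCaps G lmax) (v : V) : 1 < lmax v := by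
  have := (hL v).1
  omega

theorem LargeCaps.pos (hL : LargeCaps G lmax) (v : V) : 0 < lmax v :=
  zero_lt_one.trans (hL.one_lt v)

theorem LargeCaps.degree_le (hL : LargeCaps G lmax) (v : V) :
    (G.degree v : ℝ) * 2 ^ 15 ≤ (3 / 2) ^ lmax v := by
  refine le_of_sq_le_sq ?_ (by positivity)
  calc ((G.degree v : ℝ) * 2 ^ 15) ^ 2 = (G.degree v : ℝ) ^ 2 * 2 ^ 30 := by ring
    _ ≤ 2 ^ lmax v := (hL v).2
    _ ≤ ((3 / 2) ^ 2) ^ lmax v := pow_le_pow_left₀ (by norm_num) (by norm_num) _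
    _ = ((3 / 2) ^ lmax v) ^ 2 := by rw [← pow_mul, ← pow_mul, mul_comm]

theorem joinFailure_update_of_lonely (hL : LargeCaps G lmax) (hb : Legal lmax c b)
    (h : ¬ Hears G b u) (hu : b u = true) :
    joinFailure G lmax (update G lmax c b) u ≤ 1 / 1000 := by
  have hnbr : ∀ x, G.Adj u x → 1 ≤ c x := fun x hx => one_le_of_not_hears hb h hx
  have hhalf := nbrRate_update_le_half (lmax := lmax) hu hnbr
  have hdeg := nbrRate_le_degree_div_two (lmax := lmax) hnbr
  have hlevel : update G lmax c b u ≤ 0 := update_nonpos_of_lonely h hu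
  rw [joinFailure_of_nonpos hlevel, weight_of_nonpos hlevel, update_of_lonely h hu, zpow_neg,
    zpow_natCast, ← div_eq_mul_inv, div_le_iff₀ (by positivity)]
  linarith [hL.degree_le u]

theorem joinFailure_update_of_hears (hc : IsRegular G lmax c) (hb : Legal lmax c b)
    (h : Hears G b u) (hu : c u < 0) :
    joinFailure G lmax (update G lmax c b) u ≤ 3 / 4 * weight G lmax c u := by
  have hlevel : update G lmax c b u = c u + 1 := by rw [update_of_hears h]; omega
  have hhalf := nbrRate_update_le_half (lmax := lmax) ((hb u).1 hu.le)
    fun x hx => hc.one_le_of_adj u x hx hu.le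
  have hnonpos : update G lmax c b u ≤ 0 := update_nonpos_of_hears hu h
  rw [joinFailure_of_nonpos hnonpos, weight_of_nonpos hnonpos, weight_of_nonpos hu.le, hlevel,
    zpow_add₀ (by norm_num), zpow_one]
  have hpos : (0 : ℝ) < (3 / 2) ^ c u := by positivity
  nlinarith

theorem joinFailure_update_of_not_hears (hc : IsConfig lmax c) (hb : Legal lmax c b)
    (h : ¬ Hears G b u) (hu : c u ≤ 0) :
    joinFailure G lmax (update G lmax c b) u ≤ 1 / 2 * weight G lmax c u := by
  have hbu := (hb u).1 hu
  have hhalf := nbrRate_update_le_half (lmax := lmax) hbu fun x hx => one_le_of_not_hears hb h hx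
  have hpow : (3 / 2 : ℝ) ^ (-(lmax u : ℤ)) ≤ (3 / 2) ^ c u :=
    zpow_le_zpow_right₀ (by norm_num) (hc u).1
  have hrate := nbrRate_nonneg G lmax c u
  have hnonpos : update G lmax c b u ≤ 0 := update_nonpos_of_lonely h hbu
  rw [joinFailure_of_nonpos hnonpos, weight_of_nonpos hnonpos, weight_of_nonpos hu,
    update_of_lonely h hbu]
  calc _ ≤ 4 * (nbrRate G lmax c u / 2) * (3 / 2 : ℝ) ^ c u := by gcongr
    _ = _ := by ring

theorem roundExp_joinFailure_le (hL : LargeCaps G lmax) (hc : IsRegular G lmax c) (hu : c u ≤ 0) :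
    roundExp G lmax c (fun c' => joinFailure G lmax c' u) ≤ 3 / 4 * weight G lmax c u := by
  classical
  have hw := weight_nonneg G lmax c u
  rcases hu.lt_or_eq with hneg | hzero
  · refine roundExp_le hL.pos fun b hb => ?_
    by_cases h : Hears G b u
    · exact joinFailure_update_of_hears hc hb h hneg
    · linarith [joinFailure_update_of_not_hears hc.isConfig hb h hu]
  · have hweight : weight G lmax c u = 4 * nbrRate G lmax c u := by simp [weight, hzero]
    calc roundExp G lmax c (fun c' => joinFailure G lmax c' u)
        ≤ bernExp (rates lmax c) (fun b => 1 / 2 * weight G lmax c u +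
            (if Hears G b u then 1 else 0)) := by
          refine roundExp_le_bernExp hL.pos fun b hb => ?_
          by_cases h : Hears G b u
          · have hlevel : update G lmax c b u = 1 := by
              have := hL.pos u
              rw [update_of_hears h]
              omega
            rw [joinFailure_of_pos hlevel.ge, if_pos h]
            linarith
          · rw [if_neg h, add_zero]
            exact joinFailure_update_of_not_hears hc.isConfig hb h hu
      _ = 1 / 2 * weight G lmax c u + bernProb (rates lmax c) (fun b => Hears G b u) := by
          rw [bernExp_add, bernExp_const, bernExp_ite]
      _ ≤ 3 / 4 * weight G lmax c u := by
          linarith [bernProb_hears_le (G := G) (lmax := lmax) (c := c) u]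

theorem weight_update_of_hears_of_pos (hm : 0 < lmax u) (h : Hears G b u) (hu : 1 ≤ c u) :
    weight G lmax (update G lmax c b) u ≤ rates lmax c u / 2 := by
  rw [weight_of_pos (by rw [update_of_hears h]; omega)]
  exact rates_update_le_half h (zero_le_one.trans hu)

theorem weight_update_of_silent (h : ¬ Hears G b u) (hbu : ¬ b u = true)
    (hu : 1 ≤ c u) (hm : c u < lmax u) :
    weight G lmax (update G lmax c b) u ≤ 2 * rates lmax c u := by
  have hlevel : update G lmax c b u = max (c u - 1) 1 := update_of_silent h hbu
  rw [weight_of_pos (by rw [hlevel]; omega), rates, hlevel]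
  exact rate_max_sub_one_le hu hm

theorem weight_update_of_eq_cap (hm : 1 < lmax u) (hb : Legal lmax c b) (h : ¬ Hears G b u)
    (hu : c u = lmax u) : weight G lmax (update G lmax c b) u = 2 * 2 ^ (-(lmax u : ℤ)) := by
  have hbu : ¬ b u = true := by simp [(hb u).2 hu.ge]
  have hlevel : update G lmax c b u = max (c u - 1) 1 := update_of_silent h hbu
  rw [weight_of_pos (by rw [hlevel]; omega), rates, hlevel, hu]
  exact rate_max_cap_sub_one hm

end Weight

section WeightDrift

variable {V : Type*}

/-- `v` or one of its neighbors beeps surely, and all neighbors of that vertex are at their caps. -/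
def Settled (G : SimpleGraph V) (lmax : V → ℕ) (c : Config V) (v : V) : Prop :=
  ∃ u, (u = v ∨ G.Adj v u) ∧ c u ≤ 0 ∧ ∀ x, G.Adj u x → (lmax x : ℤ) ≤ c x

open Classical in
/-- Half the beeping probability with which `u` leaves its cap in a silent round, for the vertices
that are not settled. A settled vertex at its cap never has a silent round. -/
noncomputable def capLeak (G : SimpleGraph V) (lmax : V → ℕ) (c : Config V) (u : V) : ℝ :=
  if Settled G lmax c u then 0 else 2 ^ (-(lmax u : ℤ))

theorem capLeak_nonneg (G : SimpleGraph V) (lmax : V → ℕ) (c : Config V) (u : V) :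
    0 ≤ capLeak G lmax c u := by
  unfold capLeak
  split_ifs <;> positivity

variable {G : SimpleGraph V} {lmax : V → ℕ} {c : Config V} {b : V → Bool} {u : V}

theorem Settled.hears (hm : 0 < lmax u) (hb : Legal lmax c b) (hs : Settled G lmax c u)
    (hu : c u = lmax u) : Hears G b u := by
  obtain ⟨x, rfl | hx, hx0, -⟩ := hs
  · omega
  · exact ⟨x, hx, (hb x).1 hx0⟩

variable [Fintype V] [DecidableRel G.Adj]

variable (G lmax c) in
/-- The total cap leakage of the neighbors of `v`. -/
noncomputable def nbrLeak (v : V) : ℝ := ∑ u ∈ G.neighborFinset v, capLeak G lmax c u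

variable (G lmax c) in
/-- A vertex that has a constant probability to be the only one to beep in its neighborhood once
it beeps. -/
def Light (u : V) : Prop :=
  1 ≤ c u ∧ (∀ x, G.Adj u x → 1 ≤ c x) ∧ nbrRate G lmax c u ≤ 3

theorem roundExp_weight_le_of_nonpos (hL : LargeCaps G lmax) (hc : IsRegular G lmax c)
    (hu : c u ≤ 0) :
    roundExp G lmax c (fun c' => weight G lmax c' u) ≤ 3 / 4 * weight G lmax c u :=
  (roundExp_mono fun _ => weight_le_joinFailure u).trans (roundExp_joinFailure_le hL hc hu)

open Classical in
theorem weight_update_le_of_pos (hL : LargeCaps G lmax) (hc : IsConfig lmax c)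
    (hb : Legal lmax c b) (hu : 1 ≤ c u) :
    weight G lmax (update G lmax c b) u ≤ 1 / 2 * rates lmax c u +
      (2 * rates lmax c u * (if ¬ Hears G b u then 1 else 0) +
        (1 / 1000 * (if b u = true then 1 else 0) + 2 * capLeak G lmax c u)) := by
  have hr := rates_nonneg lmax c u
  have hleak := capLeak_nonneg G lmax c u
  by_cases h : Hears G b u
  · have hhalf := weight_update_of_hears_of_pos (hL.pos u) h hu
    have hbeep : (0 : ℝ) ≤ if b u = true then 1 else 0 := by split_ifs <;> norm_num
    rw [if_neg (not_not.2 h)]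
    linarith
  · rw [if_pos h]
    by_cases hbu : b u = true
    · rw [if_pos hbu]
      linarith [(weight_le_joinFailure u).trans (joinFailure_update_of_lonely hL hb h hbu)]
    · rw [if_neg hbu]
      rcases (hc u).2.lt_or_eq with hcap | hcap
      · linarith [weight_update_of_silent h hbu hu hcap]
      · rw [weight_update_of_eq_cap (hL.one_lt u) hb h hcap, capLeak,
          if_neg fun hs => h (hs.hears (hL.pos u) hb hcap)]
        linarith

theorem roundExp_weight_le_of_pos (hL : LargeCaps G lmax) (hc : IsConfig lmax c)
    (hu : 1 ≤ c u) :
    roundExp G lmax c (fun c' => weight G lmax c' u)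
      ≤ (501 / 1000 + 2 * silenceProb G lmax c u) * weight G lmax c u
        + 2 * capLeak G lmax c u := by
  classical
  refine (roundExp_le_bernExp (f := fun c' => weight G lmax c' u) hL.pos fun b hb =>
    weight_update_le_of_pos hL hc hb hu).trans_eq ?_
  simp only [bernExp_add, bernExp_const, bernExp_const_mul, bernExp_ite, bernProb_not_hears,
    bernProb_beep, weight_of_pos hu]
  ring

theorem roundExp_weight_le (hL : LargeCaps G lmax) (hc : IsRegular G lmax c) (u : V) :
    roundExp G lmax c (fun c' => weight G lmax c' u)
      ≤ 13 / 5 * weight G lmax c u + 2 * capLeak G lmax c u := by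
  have hw := weight_nonneg G lmax c u
  have hleak := capLeak_nonneg G lmax c u
  rcases le_or_gt (c u) 0 with hu | hu
  · linarith [roundExp_weight_le_of_nonpos hL hc hu]
  · have hdrift := roundExp_weight_le_of_pos hL hc.isConfig hu
    have hsilence := silenceProb_le_one (G := G) (lmax := lmax) (c := c) (u := u)
    nlinarith

theorem exp_neg_three_le : Real.exp (-3) ≤ 1 / 10 := by
  have hpow : (2.7 : ℝ) ^ 3 ≤ Real.exp 1 ^ 3 :=
    pow_le_pow_left₀ (by norm_num) (by linarith [Real.exp_one_gt_d9]) 3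
  rw [← Real.exp_nat_mul] at hpow
  rw [Real.exp_neg, inv_le_comm₀ (Real.exp_pos _) (by norm_num)]
  norm_num at hpow ⊢
  linarith

theorem silenceProb_le_of_not_light (hm : ∀ v, 0 < lmax v) (hpos : 1 ≤ c u)
    (hu : ¬ Light G lmax c u) : silenceProb G lmax c u ≤ 1 / 10 := by
  by_cases hnbr : ∀ x, G.Adj u x → 1 ≤ c x
  · have hrate : 3 < nbrRate G lmax c u := by
      by_contra hrate
      exact hu ⟨hpos, hnbr, not_lt.1 hrate⟩
    calc silenceProb G lmax c u ≤ Real.exp (-nbrRate G lmax c u) :=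
          prod_one_sub_le_exp fun x _ => (rates_mem_Icc x).2
      _ ≤ Real.exp (-3) := Real.exp_le_exp.2 (neg_le_neg hrate.le)
      _ ≤ 1 / 10 := exp_neg_three_le
  · push Not at hnbr
    obtain ⟨x, hx, hcx⟩ := hnbr
    rw [silenceProb, Finset.prod_eq_zero (i := x) (by simpa using hx)]
    · norm_num
    · rw [rates, rate_of_nonpos (hm x) (by omega), sub_self]

theorem roundExp_weight_le_of_not_light (hL : LargeCaps G lmax) (hc : IsRegular G lmax c)
    (hu : ¬ Light G lmax c u) :
    roundExp G lmax c (fun c' => weight G lmax c' u)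
      ≤ 3 / 4 * weight G lmax c u + 2 * capLeak G lmax c u := by
  have hw := weight_nonneg G lmax c u
  have hleak := capLeak_nonneg G lmax c u
  rcases le_or_gt (c u) 0 with hpos | hpos
  · linarith [roundExp_weight_le_of_nonpos hL hc hpos]
  · have hdrift := roundExp_weight_le_of_pos hL hc.isConfig hpos
    have hsilence := silenceProb_le_of_not_light hL.pos hpos hu
    nlinarith

end WeightDrift

section VertexDrift

variable {V : Type*} [Fintype V] (G : SimpleGraph V) [DecidableRel G.Adj] (lmax : V → ℕ)
  (c : Config V)

open Classical in
/-- The light neighbors of `v`. -/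
noncomputable def lightNbrs (v : V) : Finset V := {u ∈ G.neighborFinset v | Light G lmax c u}

/-- The total weight of the neighbors of `v`. -/
noncomputable def nbrWeight (v : V) : ℝ := ∑ u ∈ G.neighborFinset v, weight G lmax c u

/-- A bound on the probability that no vertex of the closed neighborhood of `v` that currently
beeps surely will join the MIS. -/
noncomputable def failure (v : V) : ℝ :=
  min 1 (⨅ u : {u // u = v ∨ G.Adj v u}, joinFailure G lmax c u)

/-- The weight of the neighbors of `v`, scaled by a power of the level of `v`: it tends to shrink
as long as `v` has no good chance to become settled in the next round. The summand `1 / 100` keeps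
it positive, so that it also measures the level of `v` when the neighbors have no weight left. -/
noncomputable def spread (v : V) : ℝ :=
  (6 / 5 : ℝ) ^ max (c v) 1 * (nbrWeight G lmax c v + 1 / 100)

theorem nbrWeight_nonneg (v : V) : 0 ≤ nbrWeight G lmax c v :=
  Finset.sum_nonneg fun _ _ => weight_nonneg _ _ _ _

theorem joinFailure_nonneg (u : V) : 0 ≤ joinFailure G lmax c u :=
  (weight_nonneg G lmax c u).trans (weight_le_joinFailure u)

theorem failure_nonneg (v : V) : 0 ≤ failure G lmax c v :=
  le_min zero_le_one (Real.iInf_nonneg fun u => joinFailure_nonneg G lmax c u)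

theorem failure_le_one (v : V) : failure G lmax c v ≤ 1 := min_le_left _ _

theorem spread_pos (v : V) : 0 < spread G lmax c v := by
  have := nbrWeight_nonneg G lmax c v
  unfold spread
  positivity

variable {G lmax c} {b : V → Bool} {u v : V}

theorem failure_le_joinFailure (hu : u = v ∨ G.Adj v u) :
    failure G lmax c v ≤ joinFailure G lmax c u :=
  (min_le_right _ _).trans <| ciInf_le (f := fun u : {u // u = v ∨ G.Adj v u} =>
    joinFailure G lmax c u) (Set.finite_range _).bddBelow ⟨u, hu⟩

theorem failure_le_weight (hu : u = v ∨ G.Adj v u) (hnonpos : c u ≤ 0) :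
    failure G lmax c v ≤ weight G lmax c u :=
  (failure_le_joinFailure hu).trans_eq (joinFailure_of_nonpos hnonpos)

theorem exists_failure_eq_weight (h : failure G lmax c v < 1) :
    ∃ u, (u = v ∨ G.Adj v u) ∧ c u ≤ 0 ∧ failure G lmax c v = weight G lmax c u := by
  have : Nonempty {u // u = v ∨ G.Adj v u} := ⟨⟨v, .inl rfl⟩⟩
  obtain ⟨⟨u, hu⟩, hmin⟩ := exists_eq_ciInf_of_finite
    (f := fun u : {u // u = v ∨ G.Adj v u} => joinFailure G lmax c u)
  have hlt : joinFailure G lmax c u < 1 := by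
    rw [hmin]
    exact (min_lt_iff.1 h).resolve_left (lt_irrefl 1)
  have hnonpos : c u ≤ 0 := by
    by_contra hpos
    exact hlt.ne (joinFailure_of_pos (by omega))
  refine ⟨u, hu, hnonpos, ?_⟩
  rw [← joinFailure_of_nonpos hnonpos, failure, ← hmin]
  exact min_eq_right hlt.le

theorem roundExp_failure_le_one (hm : ∀ v, 0 < lmax v) :
    roundExp G lmax c (fun c' => failure G lmax c' v) ≤ 1 :=
  roundExp_le hm fun _ _ => failure_le_one _ _ _ _

theorem roundExp_failure_le_of_lt_one (hL : LargeCaps G lmax) (hc : IsRegular G lmax c)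
    (h : failure G lmax c v < 1) :
    roundExp G lmax c (fun c' => failure G lmax c' v) ≤ 3 / 4 * failure G lmax c v := by
  obtain ⟨u, hu, hnonpos, heq⟩ := exists_failure_eq_weight h
  rw [heq]
  exact (roundExp_mono fun _ => failure_le_joinFailure hu).trans
    (roundExp_joinFailure_le hL hc hnonpos)

theorem roundExp_failure_le_of_silenceProb (hL : LargeCaps G lmax) {s : Finset V}
    (hs : ∀ u ∈ s, u = v ∨ G.Adj v u) {k : ℝ} (hk : ∀ u ∈ s, k ≤ silenceProb G lmax c u) :
    roundExp G lmax c (fun c' => failure G lmax c' v)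
      ≤ 1 - 999 / 1000 * (k * (1 - ∏ u ∈ s, (1 - rates lmax c u))) := by
  classical
  have hlonely : k * (1 - ∏ u ∈ s, (1 - rates lmax c u))
      ≤ bernProb (rates lmax c) (fun b => ∃ u ∈ s, b u = true ∧ ¬ Hears G b u) := by
    simpa only [not_hears_iff] using le_bernProb_exists_lonely rates_mem_Icc
      (N := fun u => G.neighborFinset u) (fun u => G.notMem_neighborFinset_self u) s hk
  calc roundExp G lmax c (fun c' => failure G lmax c' v)
      ≤ bernExp (rates lmax c) (fun b => 1 + -(999 / 1000) *
          (if ∃ u ∈ s, b u = true ∧ ¬ Hears G b u then 1 else 0)) := by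
        refine roundExp_le_bernExp hL.pos fun b hb => ?_
        split_ifs with h
        · obtain ⟨u, hu, hbu, hsilent⟩ := h
          linarith [(failure_le_joinFailure (hs u hu)).trans
            (joinFailure_update_of_lonely hL hb hsilent hbu)]
        · linarith [failure_le_one G lmax (update G lmax c b) v]
    _ = 1 - 999 / 1000 *
          bernProb (rates lmax c) (fun b => ∃ u ∈ s, b u = true ∧ ¬ Hears G b u) := by
        rw [bernExp_add, bernExp_const, bernExp_const_mul, bernExp_ite]
        ring
    _ ≤ _ := by gcongr

theorem exp_neg_nbrRate_le_silenceProb (h : ∀ x, G.Adj u x → 1 ≤ c x) :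
    Real.exp (-(2 * nbrRate G lmax c u)) ≤ silenceProb G lmax c u :=
  exp_le_prod_one_sub (fun _ _ => rates_nonneg _ _ _)
    fun x hx => rate_le_half (h x (by simpa using hx))

theorem roundExp_nbrWeight_le (hL : LargeCaps G lmax) (hc : IsRegular G lmax c) (v : V) :
    roundExp G lmax c (fun c' => nbrWeight G lmax c' v)
      ≤ 13 / 5 * nbrWeight G lmax c v + 2 * nbrLeak G lmax c v := by
  simp only [roundExp, nbrWeight, nbrLeak, bernExp_sum, Finset.mul_sum, ← Finset.sum_add_distrib]
  exact Finset.sum_le_sum fun u _ => roundExp_weight_le hL hc u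

theorem roundExp_nbrWeight_le_of_lightNbrs (hL : LargeCaps G lmax) (hc : IsRegular G lmax c)
    (v : V) :
    roundExp G lmax c (fun c' => nbrWeight G lmax c' v)
      ≤ 3 / 4 * nbrWeight G lmax c v + 2 * nbrLeak G lmax c v
        + 13 / 5 * ∑ u ∈ lightNbrs G lmax c v, rates lmax c u := by
  simp only [roundExp, nbrWeight, nbrLeak, lightNbrs, Finset.sum_filter, bernExp_sum,
    Finset.mul_sum, ← Finset.sum_add_distrib]
  refine Finset.sum_le_sum fun u _ => ?_
  split_ifs with hlight
  · have hdrift : roundExp G lmax c (fun c' => weight G lmax c' u) ≤ _ :=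
      roundExp_weight_le hL hc u
    rw [roundExp, weight_of_pos hlight.1] at hdrift
    rw [weight_of_pos hlight.1]
    linarith [rates_nonneg lmax c u]
  · rw [mul_zero, add_zero]
    exact roundExp_weight_le_of_not_light hL hc hlight

theorem spread_update_le (v : V) :
    spread G lmax (update G lmax c b) v ≤
      (6 / 5 : ℝ) ^ max (c v) 1 * (6 / 5 * (nbrWeight G lmax (update G lmax c b) v + 1 / 100)) := by
  have hlevel : max (update G lmax c b v) 1 ≤ max (c v) 1 + 1 := by
    by_cases h : Hears G b v
    · rw [update_of_hears h]; omega
    · by_cases hv : b v = true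
      · rw [update_of_lonely h hv]; omega
      · rw [update_of_silent h hv]; omega
  have hw := nbrWeight_nonneg G lmax (update G lmax c b) v
  rw [spread, ← mul_assoc, ← zpow_add_one₀ (by norm_num)]
  gcongr
  norm_num

theorem spread_update_le_of_not_hears (h : ¬ Hears G b v) (hv : 2 ≤ c v) :
    spread G lmax (update G lmax c b) v ≤
      (6 / 5 : ℝ) ^ max (c v) 1 * (5 / 6 * (nbrWeight G lmax (update G lmax c b) v + 1 / 100)) := by
  have hlevel : max (update G lmax c b v) 1 ≤ max (c v) 1 - 1 := by
    by_cases hbv : b v = true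
    · rw [update_of_lonely h hbv]; omega
    · rw [update_of_silent h hbv]; omega
  have hw := nbrWeight_nonneg G lmax (update G lmax c b) v
  rw [spread, ← mul_assoc, show (5 / 6 : ℝ) = (6 / 5)⁻¹ by norm_num,
    ← zpow_sub_one₀ (by norm_num)]
  gcongr
  norm_num

theorem roundExp_spread_le (hm : ∀ v, 0 < lmax v) (v : V) :
    roundExp G lmax c (fun c' => spread G lmax c' v) ≤ (6 / 5 : ℝ) ^ max (c v) 1 *
      (6 / 5 * (roundExp G lmax c (fun c' => nbrWeight G lmax c' v) + 1 / 100)) := by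
  refine (roundExp_le_bernExp (f := fun c' => spread G lmax c' v) hm
    fun _ _ => spread_update_le v).trans_eq ?_
  rw [bernExp_const_mul, bernExp_const_mul, bernExp_add, bernExp_const]
  rfl

-- `1 / 120 = 5 / 6 * (1 / 100)`, and `11 / 3000` is the gap to `6 / 5 * (1 / 100)`.
theorem roundExp_spread_le_of_two_le (hm : ∀ v, 0 < lmax v) (hv : 2 ≤ c v) :
    roundExp G lmax c (fun c' => spread G lmax c' v) ≤ (6 / 5 : ℝ) ^ max (c v) 1 *
      (6 / 5 * roundExp G lmax c (fun c' => nbrWeight G lmax c' v)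
        + (1 / 120 + 11 / 3000 * nbrRate G lmax c v)) := by
  classical
  calc roundExp G lmax c (fun c' => spread G lmax c' v)
      ≤ bernExp (rates lmax c) (fun b => (6 / 5 : ℝ) ^ max (c v) 1 *
          (6 / 5 * nbrWeight G lmax (update G lmax c b) v
            + (1 / 120 + 11 / 3000 * (if Hears G b v then 1 else 0)))) := by
        refine roundExp_le_bernExp hm fun b _ => ?_
        have hw := nbrWeight_nonneg G lmax (update G lmax c b) v
        split_ifs with h
        · refine (spread_update_le v).trans ?_
          gcongr
          linarith
        · refine (spread_update_le_of_not_hears h hv).trans ?_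
          gcongr
          linarith
    _ = (6 / 5 : ℝ) ^ max (c v) 1 *
          (6 / 5 * roundExp G lmax c (fun c' => nbrWeight G lmax c' v)
            + (1 / 120 + 11 / 3000 * bernProb (rates lmax c) (fun b => Hears G b v))) := by
        rw [bernExp_const_mul, bernExp_add, bernExp_add, bernExp_const, bernExp_const_mul,
          bernExp_const_mul, bernExp_ite]
        rfl
    _ ≤ _ := by
        gcongr
        exact bernProb_hears_le v

theorem roundExp_spread_le_four_mul (hL : LargeCaps G lmax) (hc : IsRegular G lmax c)
    (hleak : nbrLeak G lmax c v ≤ 1 / 100000) :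
    roundExp G lmax c (fun c' => spread G lmax c' v) ≤ 4 * spread G lmax c v := by
  refine (roundExp_spread_le hL.pos v).trans ?_
  rw [spread, mul_left_comm (4 : ℝ)]
  refine mul_le_mul_of_nonneg_left ?_ (by positivity)
  linarith [roundExp_nbrWeight_le hL hc v, nbrWeight_nonneg G lmax c v]

theorem le_exp_neg_six : 1 / 1000 ≤ Real.exp (-6) := by
  have hpow : Real.exp 1 ^ 6 ≤ (2.72 : ℝ) ^ 6 :=
    pow_le_pow_left₀ (Real.exp_pos _).le (by linarith [Real.exp_one_lt_d9]) 6
  rw [← Real.exp_nat_mul] at hpow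
  rw [Real.exp_neg, le_inv_comm₀ (by norm_num) (Real.exp_pos _)]
  norm_num at hpow ⊢
  linarith

theorem roundExp_failure_le_of_lightNbrs (hL : LargeCaps G lmax)
    (h : 1 / 10000 ≤ ∑ u ∈ lightNbrs G lmax c v, rates lmax c u) :
    roundExp G lmax c (fun c' => failure G lmax c' v) ≤ 1 - 1 / 10 ^ 8 := by
  classical
  have hdrift := roundExp_failure_le_of_silenceProb (c := c) (v := v) hL (k := 1 / 1000)
    (s := lightNbrs G lmax c v) (fun u hu => .inr (by simpa using (Finset.mem_filter.1 hu).1))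
    fun u hu => by
      obtain ⟨-, hnbr, hrate⟩ := (Finset.mem_filter.1 hu).2
      calc (1 / 1000 : ℝ) ≤ Real.exp (-6) := le_exp_neg_six
        _ ≤ Real.exp (-(2 * nbrRate G lmax c u)) := Real.exp_le_exp.2 (by linarith)
        _ ≤ silenceProb G lmax c u := exp_neg_nbrRate_le_silenceProb hnbr
  have hbeep : ∏ u ∈ lightNbrs G lmax c v, (1 - rates lmax c u) ≤ 10000 / 10001 :=
    calc _ ≤ Real.exp (-∑ u ∈ lightNbrs G lmax c v, rates lmax c u) :=
          prod_one_sub_le_exp fun u _ => (rates_mem_Icc u).2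
      _ ≤ Real.exp (-(1 / 10000)) := Real.exp_le_exp.2 (neg_le_neg h)
      _ ≤ 10000 / 10001 := by
          have := Real.add_one_le_exp (1 / 10000 : ℝ)
          rw [Real.exp_neg, inv_le_comm₀ (Real.exp_pos _) (by norm_num)]
          norm_num at this ⊢
          linarith
  linarith

theorem one_le_of_adj_of_nbrWeight_lt (hfail : 1 ≤ failure G lmax c v)
    (hw : nbrWeight G lmax c v < 1) (hu : G.Adj v u) : 1 ≤ c u := by
  by_contra hnonpos
  have hone := hfail.trans (failure_le_weight (.inr hu) (by omega))
  have hle : weight G lmax c u ≤ nbrWeight G lmax c v :=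
    Finset.single_le_sum (fun x _ => weight_nonneg G lmax c x) (by simpa using hu)
  linarith

theorem nbrRate_eq_nbrWeight (h : ∀ u, G.Adj v u → 1 ≤ c u) :
    nbrRate G lmax c v = nbrWeight G lmax c v :=
  Finset.sum_congr rfl fun u hu => (weight_of_pos (h u (by simpa using hu))).symm

theorem one_le_of_nbrRate_lt (hfail : 1 ≤ failure G lmax c v)
    (hrate : nbrRate G lmax c v < 1 / 4) : 1 ≤ c v := by
  by_contra hpos
  have hone := hfail.trans (failure_le_weight (.inl rfl) (by omega))
  have hpow : (3 / 2 : ℝ) ^ c v ≤ 1 := zpow_le_one_of_nonpos₀ (by norm_num) (by omega)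
  rw [weight_of_nonpos (by omega)] at hone
  nlinarith [nbrRate_nonneg G lmax c v]

theorem roundExp_failure_le_of_eq_one (hL : LargeCaps G lmax) (h : ∀ u, G.Adj v u → 1 ≤ c u)
    (hrate : nbrRate G lmax c v ≤ 1 / 10) (hv : c v = 1) :
    roundExp G lmax c (fun c' => failure G lmax c' v) ≤ 1 - 1 / 10 ^ 8 := by
  have hsilence : 4 / 5 ≤ silenceProb G lmax c v := by
    have := Real.add_one_le_exp (-(2 * nbrRate G lmax c v))
    exact le_trans (by linarith) (exp_neg_nbrRate_le_silenceProb h)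
  have hdrift := roundExp_failure_le_of_silenceProb (c := c) (v := v) hL (s := {v})
    (fun u hu => .inl (Finset.mem_singleton.1 hu))
    fun u hu => (Finset.mem_singleton.1 hu).symm ▸ hsilence
  have hm := hL.one_lt v
  rw [Finset.prod_singleton, rates, hv, rate_of_nonneg zero_le_one (by omega)] at hdrift
  norm_num at hdrift ⊢
  linarith

theorem roundExp_spread_le_of_le_nbrWeight (hL : LargeCaps G lmax) (hc : IsRegular G lmax c)
    (hleak : nbrLeak G lmax c v ≤ 1 / 100000)
    (hlight : ∑ u ∈ lightNbrs G lmax c v, rates lmax c u ≤ 1 / 10000)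
    (hw : 1 / 10 ≤ nbrWeight G lmax c v) :
    roundExp G lmax c (fun c' => spread G lmax c' v) ≤ 19 / 20 * spread G lmax c v := by
  refine (roundExp_spread_le hL.pos v).trans ?_
  rw [spread, mul_left_comm (19 / 20 : ℝ)]
  refine mul_le_mul_of_nonneg_left ?_ (by positivity)
  linarith [roundExp_nbrWeight_le_of_lightNbrs hL hc v]

theorem roundExp_spread_le_of_nbrRate_le (hL : LargeCaps G lmax) (hc : IsRegular G lmax c)
    (hleak : nbrLeak G lmax c v ≤ 1 / 100000)
    (hlight : ∑ u ∈ lightNbrs G lmax c v, rates lmax c u ≤ 1 / 10000)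
    (hrate : nbrRate G lmax c v = nbrWeight G lmax c v) (hv : 2 ≤ c v) :
    roundExp G lmax c (fun c' => spread G lmax c' v) ≤ 19 / 20 * spread G lmax c v := by
  refine (roundExp_spread_le_of_two_le hL.pos hv).trans ?_
  rw [spread, mul_left_comm (19 / 20 : ℝ)]
  gcongr
  linarith [roundExp_nbrWeight_le_of_lightNbrs hL hc v, nbrWeight_nonneg G lmax c v]

theorem failure_or_spread_drift (hL : LargeCaps G lmax) (hc : IsRegular G lmax c)
    (hleak : nbrLeak G lmax c v ≤ 1 / 100000) :
    roundExp G lmax c (fun c' => failure G lmax c' v) ≤ (1 - 1 / 10 ^ 8) * failure G lmax c v ∨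
    roundExp G lmax c (fun c' => spread G lmax c' v) ≤ 19 / 20 * spread G lmax c v ∧
      roundExp G lmax c (fun c' => failure G lmax c' v) ≤ failure G lmax c v := by
  rcases (failure_le_one G lmax c v).lt_or_eq with hlt | heq
  · left
    linarith [roundExp_failure_le_of_lt_one hL hc hlt, failure_nonneg G lmax c v]
  rw [heq, mul_one]
  have hfail : roundExp G lmax c (fun c' => failure G lmax c' v) ≤ 1 :=
    roundExp_failure_le_one hL.pos
  rcases le_or_gt (1 / 10000) (∑ u ∈ lightNbrs G lmax c v, rates lmax c u) with hlight | hlight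
  · exact .inl (roundExp_failure_le_of_lightNbrs hL hlight)
  rcases le_or_gt (1 / 10) (nbrWeight G lmax c v) with hw | hw
  · exact .inr ⟨roundExp_spread_le_of_le_nbrWeight hL hc hleak hlight.le hw, hfail⟩
  have hnbr : ∀ u, G.Adj v u → 1 ≤ c u := fun u =>
    one_le_of_adj_of_nbrWeight_lt heq.ge (hw.trans (by norm_num))
  have hrate := nbrRate_eq_nbrWeight (lmax := lmax) hnbr
  rcases (one_le_of_nbrRate_lt heq.ge (by linarith)).eq_or_lt with hone | htwo
  · exact .inl (roundExp_failure_le_of_eq_one hL hnbr (by linarith) hone.symm)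
  · exact .inr ⟨roundExp_spread_le_of_nbrRate_le hL hc hleak hlight.le hrate htwo, hfail⟩

end VertexDrift

section Potential

/-- The exponent of the spread in `potential`: small enough that a round in which the spread grows
by a factor `4` while the failure bound drops by a factor `1 - 1 / 10 ^ 8` is still a gain. -/
noncomputable def spreadExponent : ℝ := 1 / (4 * 10 ^ 8)

theorem spreadExponent_pos : 0 < spreadExponent := by norm_num [spreadExponent]

theorem spreadExponent_lt_one : spreadExponent < 1 := by norm_num [spreadExponent]

theorem one_sub_spreadExponent_pos : 0 < 1 - spreadExponent := sub_pos.2 spreadExponent_lt_one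

theorem four_rpow_mul_rpow_le : (4 : ℝ) ^ spreadExponent *
    (1 - 1 / 10 ^ 8) ^ (1 - spreadExponent) ≤ Real.exp (-(1 / 10 ^ 10)) := by
  have hfour : (4 : ℝ) ≤ Real.exp 2 := by
    have hexp := Real.add_one_le_exp (1 : ℝ)
    have hsq : Real.exp 2 = Real.exp 1 * Real.exp 1 := by rw [← Real.exp_add]; norm_num
    nlinarith
  have hone : (1 : ℝ) - 1 / 10 ^ 8 ≤ Real.exp (-(1 / 10 ^ 8)) := Real.one_sub_le_exp_neg _
  calc (4 : ℝ) ^ spreadExponent * (1 - 1 / 10 ^ 8) ^ (1 - spreadExponent)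
      ≤ Real.exp 2 ^ spreadExponent * Real.exp (-(1 / 10 ^ 8)) ^ (1 - spreadExponent) := by
        gcongr
        · exact spreadExponent_pos.le
        · exact one_sub_spreadExponent_pos.le
    _ ≤ Real.exp (-(1 / 10 ^ 10)) := by
        rw [← Real.exp_mul, ← Real.exp_mul, ← Real.exp_add, Real.exp_le_exp, spreadExponent]
        norm_num

theorem rpow_spreadExponent_le : (19 / 20 : ℝ) ^ spreadExponent ≤ Real.exp (-(1 / 10 ^ 10)) := by
  have hexp : (19 / 20 : ℝ) ≤ Real.exp (-(1 / 20)) := by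
    linarith [Real.one_sub_le_exp_neg (1 / 20)]
  calc (19 / 20 : ℝ) ^ spreadExponent ≤ Real.exp (-(1 / 20)) ^ spreadExponent :=
        Real.rpow_le_rpow (by norm_num) hexp spreadExponent_pos.le
    _ ≤ Real.exp (-(1 / 10 ^ 10)) := by
        rw [← Real.exp_mul, Real.exp_le_exp, spreadExponent]
        norm_num

theorem le_rpow_of_le_one {x y e : ℝ} (hx0 : 0 < x) (hx1 : x ≤ 1) (hxy : x ≤ y) (he0 : 0 ≤ e)
    (he1 : e ≤ 1) : x ≤ y ^ e :=
  calc x = x ^ (1 : ℝ) := (Real.rpow_one x).symm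
    _ ≤ x ^ e := Real.rpow_le_rpow_of_exponent_ge hx0 hx1 he1
    _ ≤ y ^ e := Real.rpow_le_rpow hx0.le hxy he0

variable {V : Type*} [Fintype V] (G : SimpleGraph V) [DecidableRel G.Adj] (lmax : V → ℕ)
  (c : Config V)

/-- A weighted geometric mean of the spread and the failure bound of `v`; unlike the two, it
contracts in every round as long as the neighbors of `v` leak little. -/
noncomputable def potential (v : V) : ℝ :=
  spread G lmax c v ^ spreadExponent * failure G lmax c v ^ (1 - spreadExponent)

theorem potential_nonneg (v : V) : 0 ≤ potential G lmax c v :=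
  mul_nonneg (Real.rpow_nonneg (spread_pos G lmax c v).le _)
    (Real.rpow_nonneg (failure_nonneg G lmax c v) _)

variable {G lmax c} {L : ℕ} {u v : V}

theorem roundExp_potential_le_of_drift {x y : ℝ} (hx : 0 ≤ x) (hy : 0 ≤ y)
    (hspread : roundExp G lmax c (fun c' => spread G lmax c' v) ≤ x * spread G lmax c v)
    (hfailure : roundExp G lmax c (fun c' => failure G lmax c' v) ≤ y * failure G lmax c v) :
    roundExp G lmax c (fun c' => potential G lmax c' v)
      ≤ x ^ spreadExponent * y ^ (1 - spreadExponent) * potential G lmax c v := by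
  have hs := fun c' => (spread_pos G lmax c' v).le
  have hf := fun c' => failure_nonneg G lmax c' v
  calc roundExp G lmax c (fun c' => potential G lmax c' v)
      ≤ roundExp G lmax c (fun c' => spread G lmax c' v) ^ spreadExponent *
          roundExp G lmax c (fun c' => failure G lmax c' v) ^ (1 - spreadExponent) :=
        bernExp_rpow_mul_rpow_le rates_mem_Icc (fun _ => hs _) (fun _ => hf _)
          spreadExponent_pos spreadExponent_lt_one
    _ ≤ (x * spread G lmax c v) ^ spreadExponent *
          (y * failure G lmax c v) ^ (1 - spreadExponent) := by
        refine mul_le_mul (Real.rpow_le_rpow ?_ hspread spreadExponent_pos.le)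
          (Real.rpow_le_rpow ?_ hfailure one_sub_spreadExponent_pos.le)
          (Real.rpow_nonneg ?_ _) (Real.rpow_nonneg (mul_nonneg hx (hs c)) _)
        exacts [bernExp_nonneg rates_mem_Icc fun _ => hs _,
          bernExp_nonneg rates_mem_Icc fun _ => hf _, bernExp_nonneg rates_mem_Icc fun _ => hf _]
    _ = _ := by
        rw [Real.mul_rpow hx (hs c), Real.mul_rpow hy (hf c), mul_mul_mul_comm, potential]

theorem roundExp_potential_le (hL : LargeCaps G lmax) (hc : IsRegular G lmax c)
    (hleak : nbrLeak G lmax c v ≤ 1 / 100000) :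
    roundExp G lmax c (fun c' => potential G lmax c' v)
      ≤ Real.exp (-(1 / 10 ^ 10)) * potential G lmax c v := by
  rcases failure_or_spread_drift hL hc hleak with hfailure | ⟨hspread, hfailure⟩
  · refine (roundExp_potential_le_of_drift (by norm_num) (by norm_num)
      (roundExp_spread_le_four_mul hL hc hleak) hfailure).trans ?_
    exact mul_le_mul_of_nonneg_right four_rpow_mul_rpow_le (potential_nonneg G lmax c v)
  · refine (roundExp_potential_le_of_drift (by norm_num) zero_le_one hspread
      (hfailure.trans_eq (one_mul _).symm)).trans ?_
    rw [Real.one_rpow, mul_one]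
    exact mul_le_mul_of_nonneg_right rpow_spreadExponent_le (potential_nonneg G lmax c v)

theorem le_weight_of_not_settled (hm : ∀ v, 0 < lmax v) (hc : IsConfig lmax c)
    (hcap : ∀ v, lmax v ≤ L) (hv : ¬ Settled G lmax c v) (hu : u = v ∨ G.Adj v u)
    (hnonpos : c u ≤ 0) : ((3 : ℝ) ^ L)⁻¹ ≤ weight G lmax c u := by
  obtain ⟨x, hux, hx⟩ : ∃ x, G.Adj u x ∧ c x < lmax x := by
    by_contra! hx
    exact hv ⟨u, hu, hnonpos, hx⟩
  have hrate : ((2 : ℝ) ^ L)⁻¹ ≤ nbrRate G lmax c u :=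
    (le_rate_of_lt hx (hcap x) (hm x)).trans
      (Finset.single_le_sum (fun y _ => rates_nonneg lmax c y) (by simpa using hux))
  have hpow : ((3 / 2 : ℝ) ^ L)⁻¹ ≤ (3 / 2) ^ c u := by
    rw [← zpow_natCast, ← zpow_neg]
    refine zpow_le_zpow_right₀ (by norm_num) ?_
    have := (hc u).1
    have := hcap u
    omega
  have hnonneg := nbrRate_nonneg G lmax c u
  rw [weight_of_nonpos hnonpos]
  calc ((3 : ℝ) ^ L)⁻¹ = ((2 : ℝ) ^ L)⁻¹ * ((3 / 2 : ℝ) ^ L)⁻¹ := by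
        rw [← mul_inv, ← mul_pow]; norm_num
    _ ≤ nbrRate G lmax c u * (3 / 2) ^ c u := by gcongr
    _ ≤ 4 * nbrRate G lmax c u * (3 / 2) ^ c u := by
        gcongr
        linarith

theorem le_failure_of_not_settled (hm : ∀ v, 0 < lmax v) (hc : IsConfig lmax c)
    (hcap : ∀ v, lmax v ≤ L) (hv : ¬ Settled G lmax c v) :
    ((3 : ℝ) ^ L)⁻¹ ≤ failure G lmax c v := by
  rcases (failure_le_one G lmax c v).lt_or_eq with hlt | heq
  · obtain ⟨u, hu, hnonpos, hweight⟩ := exists_failure_eq_weight hlt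
    exact hweight ▸ le_weight_of_not_settled hm hc hcap hv hu hnonpos
  · exact heq ▸ inv_le_one_of_one_le₀ (one_le_pow₀ (by norm_num))

theorem le_spread : 1 / 100 ≤ spread G lmax c v := by
  have hpow : (1 : ℝ) ≤ (6 / 5 : ℝ) ^ max (c v) 1 := one_le_zpow₀ (by norm_num) (by omega)
  rw [spread]
  nlinarith [nbrWeight_nonneg G lmax c v]

theorem le_potential_of_not_settled (hm : ∀ v, 0 < lmax v) (hc : IsConfig lmax c)
    (hcap : ∀ v, lmax v ≤ L) (hv : ¬ Settled G lmax c v) :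
    1 / 100 * ((3 : ℝ) ^ L)⁻¹ ≤ potential G lmax c v :=
  mul_le_mul
    (le_rpow_of_le_one (by norm_num) (by norm_num) le_spread spreadExponent_pos.le
      spreadExponent_lt_one.le)
    (le_rpow_of_le_one (by positivity) (inv_le_one_of_one_le₀ (one_le_pow₀ (by norm_num)))
      (le_failure_of_not_settled hm hc hcap hv) one_sub_spreadExponent_pos.le
      (sub_le_self _ spreadExponent_pos.le))
    (by positivity) (Real.rpow_nonneg (spread_pos G lmax c v).le _)

theorem sum_neighborFinset_le {f : V → ℝ} {k : ℝ} (hk : 0 ≤ k) (h : ∀ x, f x ≤ k) (u : V) :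
    ∑ x ∈ G.neighborFinset u, f x ≤ Fintype.card V * k := by
  refine (Finset.sum_le_card_nsmul _ _ _ fun x _ => h x).trans ?_
  rw [nsmul_eq_mul]
  gcongr
  exact Finset.card_le_univ _

theorem weight_le (u : V) : weight G lmax c u ≤ 4 * Fintype.card V := by
  have hcard : (1 : ℝ) ≤ Fintype.card V := by exact_mod_cast Fintype.card_pos_iff.2 ⟨u⟩
  rcases le_or_gt (c u) 0 with hu | hu
  · have hrate : nbrRate G lmax c u ≤ Fintype.card V * 1 :=
      sum_neighborFinset_le zero_le_one (fun x => (rates_mem_Icc x).2) u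
    have hpow : (3 / 2 : ℝ) ^ c u ≤ 1 := zpow_le_one_of_nonpos₀ (by norm_num) hu
    rw [weight_of_nonpos hu]
    nlinarith [nbrRate_nonneg G lmax c u]
  · rw [weight_of_pos hu]
    linarith [(rates_mem_Icc u : rates lmax c u ∈ _).2]

theorem spread_le (hm : ∀ v, 0 < lmax v) (hc : IsConfig lmax c) (hcap : ∀ v, lmax v ≤ L) (v : V) :
    spread G lmax c v ≤ 5 * 2 ^ L * (Fintype.card V : ℝ) ^ 2 := by
  have hcard : (1 : ℝ) ≤ Fintype.card V := by exact_mod_cast Fintype.card_pos_iff.2 ⟨v⟩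
  have hw : nbrWeight G lmax c v ≤ Fintype.card V * (4 * Fintype.card V) :=
    sum_neighborFinset_le (by positivity) weight_le v
  have hlevel : max (c v) 1 ≤ L := by
    have := (hc v).2
    have := hcap v
    have := hm v
    omega
  have hpow : (6 / 5 : ℝ) ^ max (c v) 1 ≤ 2 ^ L :=
    calc (6 / 5 : ℝ) ^ max (c v) 1 ≤ (6 / 5 : ℝ) ^ (L : ℤ) :=
          zpow_le_zpow_right₀ (by norm_num) hlevel
      _ ≤ 2 ^ L := by rw [zpow_natCast]; gcongr; norm_num
  have hnonneg := nbrWeight_nonneg G lmax c v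
  calc spread G lmax c v ≤ (2 : ℝ) ^ L * (5 * (Fintype.card V : ℝ) ^ 2) :=
        mul_le_mul hpow (by nlinarith) (by linarith) (by positivity)
    _ = _ := by ring

theorem potential_le (hm : ∀ v, 0 < lmax v) (hc : IsConfig lmax c) (hcap : ∀ v, lmax v ≤ L)
    (v : V) : potential G lmax c v ≤ 5 * 2 ^ L * (Fintype.card V : ℝ) ^ 2 := by
  have hcard : (1 : ℝ) ≤ Fintype.card V := by exact_mod_cast Fintype.card_pos_iff.2 ⟨v⟩
  have hspread : (1 : ℝ) ≤ 5 * 2 ^ L * (Fintype.card V : ℝ) ^ 2 := by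
    have hL : (1 : ℝ) ≤ 2 ^ L := one_le_pow₀ (by norm_num)
    nlinarith
  calc potential G lmax c v ≤ spread G lmax c v ^ spreadExponent * 1 :=
        mul_le_mul_of_nonneg_left
          (Real.rpow_le_one (failure_nonneg G lmax c v) (failure_le_one G lmax c v)
            one_sub_spreadExponent_pos.le)
          (Real.rpow_nonneg (spread_pos G lmax c v).le _)
    _ ≤ (5 * 2 ^ L * (Fintype.card V : ℝ) ^ 2) ^ spreadExponent := by
        rw [mul_one]
        exact Real.rpow_le_rpow (spread_pos G lmax c v).le (spread_le hm hc hcap v)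
          spreadExponent_pos.le
    _ ≤ 5 * 2 ^ L * (Fintype.card V : ℝ) ^ 2 :=
        Real.rpow_le_self_of_one_le hspread spreadExponent_lt_one.le

end Potential

section Stability

variable {V : Type*} {G : SimpleGraph V} {lmax : V → ℕ} {c : Config V} {b : V → Bool} {u v : V}

theorem mem_misSet_update (hb : Legal lmax c b) (hu : c u ≤ 0)
    (hx : ∀ x, G.Adj u x → (lmax x : ℤ) ≤ c x) : u ∈ misSet G lmax (update G lmax c b) := by
  have hbu := (hb u).1 hu
  have hsilent : ¬ Hears G b u := by
    rintro ⟨x, hux, hbx⟩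
    simp [(hb x).2 (hx x hux)] at hbx
  refine ⟨update_of_lonely hsilent hbu, fun x hux => ?_⟩
  rw [update_of_hears ⟨u, hux.symm, hbu⟩]
  have := hx x hux
  omega

theorem Settled.update (hb : Legal lmax c b) (hv : Settled G lmax c v) :
    Settled G lmax (update G lmax c b) v := by
  obtain ⟨u, hu, hnonpos, hx⟩ := hv
  obtain ⟨hbottom, hcap⟩ := mem_misSet_update hb hnonpos hx
  exact ⟨u, hu, by omega, fun x hux => (hcap x hux).ge⟩

theorem misSet_subset_misSet_update (hb : Legal lmax c b) :
    misSet G lmax c ⊆ misSet G lmax (update G lmax c b) :=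
  fun v hv => mem_misSet_update hb (by have := hv.1; omega) fun x hx => (hv.2 x hx).ge

theorem stableSet_update_of_settled (hb : Legal lmax c b) (hs : ∀ v, Settled G lmax c v) :
    stableSet G lmax (update G lmax c b) = Set.univ := by
  refine Set.eq_univ_of_forall fun v => ?_
  obtain ⟨u, rfl | hu, hnonpos, hx⟩ := hs v
  · exact .inl (mem_misSet_update hb hnonpos hx)
  · exact .inr ⟨u, mem_misSet_update hb hnonpos hx, hu.symm⟩

theorem isIndepSet_misSet (hm : ∀ v, 0 < lmax v) : G.IsIndepSet (misSet G lmax c) := by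
  intro u hu v hv _ huv
  have hcap := hu.2 v huv
  have hbottom := hv.1
  have := hm v
  omega

theorem maximal_isIndepSet_misSet (hm : ∀ v, 0 < lmax v)
    (hs : stableSet G lmax c = Set.univ) : Maximal G.IsIndepSet (misSet G lmax c) := by
  refine ⟨isIndepSet_misSet hm, fun S hS hle w hw => ?_⟩
  rcases (hs ▸ Set.mem_univ w : w ∈ stableSet G lmax c) with hw' | ⟨v, hv, hvw⟩
  · exact hw'
  · exact absurd hvw (hS (hle hv) hw hvw.ne)

theorem hears_of_update_nonpos (hm : ∀ v, 1 < lmax v) (hb : Legal lmax c b)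
    {x : V} (hux : G.Adj u x) (hu : update G lmax c b u ≤ 0) (hx : update G lmax c b x ≤ 0) :
    Hears G b u := by
  by_contra h
  have hcx := one_le_of_not_hears hb h hux
  have hmx := hm x
  by_cases hbu : b u = true
  · rw [update_of_hears ⟨u, hux.symm, hbu⟩] at hx
    omega
  · rw [update_of_silent h hbu] at hu
    omega

/-- Properties of configurations that no round of the algorithm can destroy. -/
def Invariant (G : SimpleGraph V) (lmax : V → ℕ) (P : Config V → Prop) : Prop :=
  ∀ c, P c → ∀ b, Legal lmax c b → P (update G lmax c b)

theorem invariant_isRegular (hm : ∀ v, 1 < lmax v) : Invariant G lmax (IsRegular G lmax) :=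
  fun _ hc _ hb => hc.update hm hb

end Stability

section PMF

variable {α β : Type*}

theorem tsum_bind_mul (q : PMF α) (g : α → PMF β) (f : β → ℝ≥0∞) :
    ∑' y, q.bind g y * f y = ∑' x, q x * ∑' y, g x y * f y := by
  simp only [PMF.bind_apply, ← ENNReal.tsum_mul_right, ← ENNReal.tsum_mul_left, ← mul_assoc]
  exact ENNReal.tsum_comm

theorem tsum_map_mul (q : PMF α) (g : α → β) (f : β → ℝ≥0∞) :
    ∑' y, q.map g y * f y = ∑' x, q x * f (g x) := by
  classical
  simp only [PMF.map, tsum_bind_mul, Function.comp_apply, PMF.pure_apply, ite_mul, one_mul,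
    zero_mul, tsum_ite_eq]

theorem tsum_mul_le_tsum_mul (q : PMF α) {f g : α → ℝ≥0∞} (h : ∀ x ∈ q.support, f x ≤ g x) :
    ∑' x, q x * f x ≤ ∑' x, q x * g x := by
  refine ENNReal.tsum_le_tsum fun x => ?_
  by_cases hx : x ∈ q.support
  · gcongr
    exact h x hx
  · rw [PMF.mem_support_iff, not_not] at hx
    simp [hx]

theorem toOuterMeasure_eq_tsum_mul (q : PMF α) (s : Set α) :
    q.toOuterMeasure s = ∑' x, q x * s.indicator 1 x := by
  rw [PMF.toOuterMeasure_apply]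
  refine tsum_congr fun x => ?_
  by_cases hx : x ∈ s <;> simp [hx]

theorem toOuterMeasure_le_one (q : PMF α) (s : Set α) : q.toOuterMeasure s ≤ 1 :=
  (MeasureTheory.measure_mono s.subset_univ).trans_eq <|
    (q.toOuterMeasure_apply_eq_one_iff _).2 (Set.subset_univ _)

theorem mul_toOuterMeasure_le_tsum_mul (q : PMF α) {s : Set α} {f : α → ℝ≥0∞} {m : ℝ≥0∞}
    (h : ∀ x ∈ q.support, x ∈ s → m ≤ f x) : m * q.toOuterMeasure s ≤ ∑' x, q x * f x := by
  rw [toOuterMeasure_eq_tsum_mul, ← ENNReal.tsum_mul_left]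
  simp only [mul_left_comm m]
  refine tsum_mul_le_tsum_mul q fun x hx => ?_
  by_cases hs : x ∈ s
  · simpa [hs] using h x hx hs
  · simp [hs]

theorem toOuterMeasure_bind_le (q : PMF α) (g : α → PMF β) {s : Set α} {s' : Set β}
    {d : ℝ≥0∞} (h : ∀ x ∈ q.support, x ∉ s → (g x).toOuterMeasure s' ≤ d) :
    (q.bind g).toOuterMeasure s' ≤ q.toOuterMeasure s + d := by
  calc (q.bind g).toOuterMeasure s' = ∑' x, q x * (g x).toOuterMeasure s' :=
        q.toOuterMeasure_bind_apply g s'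
    _ ≤ ∑' x, q x * (s.indicator 1 x + d) := by
        refine tsum_mul_le_tsum_mul q fun x hx => ?_
        by_cases hs : x ∈ s
        · simpa [hs] using le_add_right (toOuterMeasure_le_one (g x) s')
        · simpa [hs] using h x hx hs
    _ = q.toOuterMeasure s + d := by
        simp only [mul_add, ENNReal.tsum_add, ENNReal.tsum_mul_right, PMF.tsum_coe, one_mul,
          toOuterMeasure_eq_tsum_mul]

theorem one_sub_le_toReal_toOuterMeasure (q : PMF α) {s : Set α} {d : ℝ} (hd : 0 ≤ d)
    (h : q.toOuterMeasure sᶜ ≤ ENNReal.ofReal d) : 1 - d ≤ (q.toOuterMeasure s).toReal := by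
  have hfin : q.toOuterMeasure s ≠ ∞ :=
    ne_top_of_le_ne_top ENNReal.one_ne_top (toOuterMeasure_le_one q s)
  have hone : 1 ≤ ENNReal.ofReal ((q.toOuterMeasure s).toReal + d) :=
    calc (1 : ℝ≥0∞) = q.toOuterMeasure (s ∪ sᶜ) :=
          ((q.toOuterMeasure_apply_eq_one_iff _).2 (by simp)).symm
      _ ≤ q.toOuterMeasure s + q.toOuterMeasure sᶜ := MeasureTheory.measure_union_le _ _
      _ ≤ q.toOuterMeasure s + ENNReal.ofReal d := by gcongr
      _ = _ := by rw [ENNReal.ofReal_add ENNReal.toReal_nonneg hd, ENNReal.ofReal_toReal hfin]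
  rw [ENNReal.one_le_ofReal] at hone
  linarith

end PMF

section Chain

variable {V : Type*} [Fintype V] {G : SimpleGraph V} {lmax : V → ℕ} {c c' : Config V}

theorem beepLaw_apply (b : V → Bool) :
    beepLaw lmax c b = ENNReal.ofReal (bernWeight (rates lmax c) b) := by
  rw [bernWeight, ENNReal.ofReal_prod_of_nonneg fun v _ => by
    split_ifs
    · exact rates_nonneg lmax c v
    · exact sub_nonneg.2 (rates_mem_Icc v).2]
  refine Finset.prod_congr rfl fun v _ => ?_
  split_ifs
  · rw [rates, rate, ENNReal.ofReal_coe_nnreal]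
  · rw [rates, rate, ← NNReal.coe_one, ← NNReal.coe_sub (beepProb_le_one _ _),
      ENNReal.ofReal_coe_nnreal]

theorem exists_legal_of_mem_support_round (hm : ∀ v, 0 < lmax v)
    (h : c' ∈ (round G lmax c).support) : ∃ b, Legal lmax c b ∧ update G lmax c b = c' := by
  rw [round, PMF.mem_support_map_iff] at h
  obtain ⟨b, hb, rfl⟩ := h
  refine ⟨b, legal_of_bernWeight_ne_zero hm fun hzero => ?_, rfl⟩
  rw [PMF.mem_support_iff, beepLaw_apply, hzero, ENNReal.ofReal_zero] at hb
  exact hb rfl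

theorem support_law_induction (hm : ∀ v, 0 < lmax v) {P : ℕ → Config V → Prop} (h0 : P 0 c)
    (hs : ∀ t c', P t c' → ∀ b, Legal lmax c' b → P (t + 1) (update G lmax c' b)) {t : ℕ}
    (h : c' ∈ (law G lmax c t).support) : P t c' := by
  induction t generalizing c' with
  | zero =>
    rw [law, PMF.mem_support_pure_iff] at h
    exact h ▸ h0
  | succ t ih =>
    rw [law, PMF.mem_support_bind_iff] at h
    obtain ⟨c₁, hc₁, hround⟩ := h
    obtain ⟨b, hb, rfl⟩ := exists_legal_of_mem_support_round hm hround
    exact hs t c₁ (ih hc₁) b hb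

theorem Invariant.of_mem_support_law {P : Config V → Prop} (hP : Invariant G lmax P)
    (hm : ∀ v, 0 < lmax v) (h0 : P c) {t : ℕ} (h : c' ∈ (law G lmax c t).support) : P c' :=
  support_law_induction (P := fun _ => P) hm h0 (fun _ => hP) h

theorem law_add (s t : ℕ) :
    law G lmax c (s + t) = (law G lmax c s).bind fun c' => law G lmax c' t := by
  induction t with
  | zero => exact (PMF.bind_pure _).symm
  | succ t ih => rw [← add_assoc, law, ih, PMF.bind_bind]; rfl

theorem tsum_round_mul {f : Config V → ℝ} (hf : ∀ c', 0 ≤ f c') :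
    ∑' c', round G lmax c c' * ENNReal.ofReal (f c') = ENNReal.ofReal (roundExp G lmax c f) := by
  classical
  have hw := bernWeight_nonneg (rates_mem_Icc (lmax := lmax) (c := c))
  rw [round, tsum_map_mul, tsum_fintype, roundExp, bernExp,
    ENNReal.ofReal_sum_of_nonneg fun b _ => mul_nonneg (hw b) (hf _)]
  simp only [beepLaw_apply, ENNReal.ofReal_mul (hw _)]

theorem tsum_law_mul_le (hm : ∀ v, 0 < lmax v) {P : Config V → Prop} (hP : Invariant G lmax P)
    (h0 : P c) {f : Config V → ℝ} (hf : ∀ c', 0 ≤ f c') {k : ℝ} (hk : 0 ≤ k)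
    (h : ∀ c', P c' → roundExp G lmax c' f ≤ k * f c') (t : ℕ) :
    ∑' c', law G lmax c t c' * ENNReal.ofReal (f c') ≤ ENNReal.ofReal (k ^ t * f c) := by
  classical
  induction t with
  | zero => simp [law, PMF.pure_apply, ite_mul]
  | succ t ih =>
    calc ∑' c', law G lmax c (t + 1) c' * ENNReal.ofReal (f c')
        = ∑' c₁, law G lmax c t c₁ * ENNReal.ofReal (roundExp G lmax c₁ f) := by
          simp only [law, tsum_bind_mul, tsum_round_mul hf]
      _ ≤ ∑' c₁, law G lmax c t c₁ * (ENNReal.ofReal k * ENNReal.ofReal (f c₁)) := by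
          refine tsum_mul_le_tsum_mul _ fun c₁ hc₁ => ?_
          rw [← ENNReal.ofReal_mul hk]
          exact ENNReal.ofReal_le_ofReal (h c₁ (hP.of_mem_support_law hm h0 hc₁))
      _ = ENNReal.ofReal k * ∑' c₁, law G lmax c t c₁ * ENNReal.ofReal (f c₁) := by
          simp only [mul_left_comm _ (ENNReal.ofReal k), ENNReal.tsum_mul_left]
      _ ≤ ENNReal.ofReal k * ENNReal.ofReal (k ^ t * f c) := by gcongr
      _ = ENNReal.ofReal (k ^ (t + 1) * f c) := by
          rw [← ENNReal.ofReal_mul hk, pow_succ', mul_assoc]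

-- Adjacent vertices that both beep surely raise each other's level in every round.
theorem le_level_of_mem_support_law (hm : ∀ v, 1 < lmax v) (hc : IsConfig lmax c) {t : ℕ}
    (h : c' ∈ (law G lmax c t).support) :
    IsConfig lmax c' ∧
      ∀ u x, G.Adj u x → c' u ≤ 0 → c' x ≤ 0 → -(lmax u : ℤ) + t ≤ c' u := by
  have hpos : ∀ v, 0 < lmax v := fun v => zero_lt_one.trans (hm v)
  refine support_law_induction (P := fun t c' => IsConfig lmax c' ∧
    ∀ u x, G.Adj u x → c' u ≤ 0 → c' x ≤ 0 → -(lmax u : ℤ) + t ≤ c' u) hpos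
    ⟨hc, fun u _ _ _ _ => by simpa using (hc u).1⟩ ?_ h
  rintro t c' ⟨hconfig, hlevel⟩ b hb
  refine ⟨hconfig.update hpos, fun u x hux hu hx => ?_⟩
  have hu_eq := update_of_hears (lmax := lmax) (c := c') (hears_of_update_nonpos hm hb hux hu hx)
  have hx_eq := update_of_hears (lmax := lmax) (c := c')
    (hears_of_update_nonpos hm hb hux.symm hx hu)
  have hmu := hpos u
  have hmx := hpos x
  have := hlevel u x hux (by omega) (by omega)
  push_cast
  omega

theorem isRegular_of_mem_support_law (hm : ∀ v, 1 < lmax v) (hc : IsConfig lmax c) {t : ℕ}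
    (ht : ∀ v, lmax v < t) (h : c' ∈ (law G lmax c t).support) : IsRegular G lmax c' := by
  obtain ⟨hconfig, hlevel⟩ := le_level_of_mem_support_law hm hc h
  refine ⟨hconfig, fun u x hux hu => ?_⟩
  by_contra hx
  have := hlevel u x hux hu (by omega)
  have := ht u
  omega

theorem stabilizedToMIS_of_stableSet_eq_univ (hm : ∀ v, 0 < lmax v)
    (hs : stableSet G lmax c = Set.univ) : StabilizedToMIS G lmax c := by
  have hmax := maximal_isIndepSet_misSet hm hs
  refine ⟨hs, hmax, fun t c' hc' => ?_⟩
  have hinv : Invariant G lmax fun c' => misSet G lmax c ⊆ misSet G lmax c' :=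
    fun _ hsub b hb => hsub.trans (misSet_subset_misSet_update hb)
  have hsub := hinv.of_mem_support_law hm subset_rfl hc'
  exact (hmax.2 (isIndepSet_misSet hm) hsub).antisymm hsub

theorem stabilizedToMIS_of_mem_support_law (hm : ∀ v, 0 < lmax v)
    (hs : ∀ v, Settled G lmax c v) {t : ℕ} (h : c' ∈ (law G lmax c (t + 1)).support) :
    StabilizedToMIS G lmax c' := by
  rw [law, PMF.mem_support_bind_iff] at h
  obtain ⟨c₁, hc₁, hround⟩ := h
  obtain ⟨b, hb, rfl⟩ := exists_legal_of_mem_support_round hm hround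
  have hinv : Invariant G lmax fun c => ∀ v, Settled G lmax c v :=
    fun _ hs _ hb v => (hs v).update hb
  exact stabilizedToMIS_of_stableSet_eq_univ hm
    (stableSet_update_of_settled hb (hinv.of_mem_support_law hm hs hc₁))

end Chain

section Phases

variable {V : Type*} [Fintype V] {G : SimpleGraph V} [DecidableRel G.Adj] {lmax : V → ℕ}
  {c c' : Config V} {L s t : ℕ} {v : V}

/-- All vertices of degree less than `s` are settled. -/
def SettledBelow (G : SimpleGraph V) [DecidableRel G.Adj] (lmax : V → ℕ) (s : ℕ)
    (c : Config V) : Prop :=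
  ∀ v, G.degree v < s → Settled G lmax c v

theorem invariant_settledBelow (s : ℕ) : Invariant G lmax (SettledBelow G lmax s) :=
  fun _ hs _ hb v hv => (hs v hv).update hb

theorem capLeak_le (hL : LargeCaps G lmax) (hs : SettledBelow G lmax s c)
    (hv : 0 < G.degree v) : capLeak G lmax c v ≤ (((max 1 s : ℕ) : ℝ) ^ 2 * 2 ^ 30)⁻¹ := by
  rw [capLeak]
  split_ifs with h
  · positivity
  · have hdeg : ((max 1 s : ℕ) : ℝ) ≤ G.degree v := by
      exact_mod_cast max_le hv (not_lt.1 fun hlt => h (hs v hlt))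
    rw [zpow_neg, zpow_natCast]
    refine inv_anti₀ (by positivity) (le_trans ?_ (hL v).2)
    gcongr

theorem nbrLeak_le (hL : LargeCaps G lmax) (hst : t ≤ 2 * max 1 s ^ 2)
    (hs : SettledBelow G lmax s c) (hv : G.degree v < t) :
    nbrLeak G lmax c v ≤ 1 / 100000 := by
  have hdeg : (G.degree v : ℝ) ≤ 2 * ((max 1 s : ℕ) : ℝ) ^ 2 := by
    exact_mod_cast (hv.trans_le hst).le
  calc nbrLeak G lmax c v ≤ G.degree v * (((max 1 s : ℕ) : ℝ) ^ 2 * 2 ^ 30)⁻¹ := by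
        rw [← SimpleGraph.card_neighborFinset_eq_degree, ← nsmul_eq_mul]
        refine Finset.sum_le_card_nsmul _ _ _ fun u hu => capLeak_le hL hs ?_
        rw [G.mem_neighborFinset] at hu
        exact (G.degree_pos_iff_exists_adj u).2 ⟨v, hu.symm⟩
    _ ≤ 2 * ((max 1 s : ℕ) : ℝ) ^ 2 * (((max 1 s : ℕ) : ℝ) ^ 2 * 2 ^ 30)⁻¹ := by gcongr
    _ = 2 / 2 ^ 30 := by field_simp
    _ ≤ 1 / 100000 := by norm_num

theorem toOuterMeasure_not_settled_le (hL : LargeCaps G lmax) (hc : IsRegular G lmax c)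
    (hcap : ∀ v, lmax v ≤ L) (hst : t ≤ 2 * max 1 s ^ 2) (hs : SettledBelow G lmax s c)
    (hv : G.degree v < t) (τ : ℕ) :
    (law G lmax c τ).toOuterMeasure {c' | ¬ Settled G lmax c' v} ≤
      ENNReal.ofReal
        (500 * Real.exp (-(1 / 10 ^ 10)) ^ τ * 6 ^ L * (Fintype.card V : ℝ) ^ 2) := by
  set k := Real.exp (-(1 / 10 ^ 10))
  have hinv : Invariant G lmax fun c' => IsRegular G lmax c' ∧ SettledBelow G lmax s c' :=
    fun c' h b hb => ⟨invariant_isRegular hL.one_lt c' h.1 b hb,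
      invariant_settledBelow s c' h.2 b hb⟩
  have hmean := tsum_law_mul_le hL.pos hinv ⟨hc, hs⟩
    (f := fun c' => potential G lmax c' v) (fun c' => potential_nonneg G lmax c' v)
    (Real.exp_nonneg _) (fun c' h => roundExp_potential_le hL h.1 (nbrLeak_le hL hst h.2 hv)) τ
  have hlarge : (0 : ℝ) < 1 / 100 * ((3 : ℝ) ^ L)⁻¹ := by positivity
  have hmarkov := (mul_toOuterMeasure_le_tsum_mul (law G lmax c τ)
    (s := {c' | ¬ Settled G lmax c' v}) fun c' hc' hv' => ENNReal.ofReal_le_ofReal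
      (le_potential_of_not_settled hL.pos (hinv.of_mem_support_law hL.pos ⟨hc, hs⟩ hc').1.isConfig
        hcap hv')).trans hmean
  rw [mul_comm, ← ENNReal.le_div_iff_mul_le (.inl (ENNReal.ofReal_pos.2 hlarge).ne')
    (.inl ENNReal.ofReal_ne_top), ← ENNReal.ofReal_div_of_pos hlarge] at hmarkov
  refine hmarkov.trans (ENNReal.ofReal_le_ofReal ?_)
  rw [div_le_iff₀ hlarge]
  calc k ^ τ * potential G lmax c v
      ≤ k ^ τ * (5 * 2 ^ L * (Fintype.card V : ℝ) ^ 2) := by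
        gcongr
        exact potential_le hL.pos hc.isConfig hcap v
    _ = 500 * k ^ τ * 6 ^ L * (Fintype.card V : ℝ) ^ 2 * (1 / 100 * ((3 : ℝ) ^ L)⁻¹) := by
        rw [show (6 : ℝ) ^ L = 2 ^ L * 3 ^ L by rw [← mul_pow]; norm_num]
        field_simp
        ring

/-- A bound on the probability that a phase of `τ` rounds fails on a graph with `n` vertices whose
caps are at most `L`: Markov's inequality with potentials between
`3⁻¹ ^ L / 100` and `5 * 2 ^ L * n ^ 2`, and a union bound. -/
noncomputable def phaseFailure (n L τ : ℕ) : ℝ :=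
  500 * Real.exp (-(1 / 10 ^ 10)) ^ τ * 6 ^ L * (n : ℝ) ^ 3

theorem toOuterMeasure_not_settledBelow_le (hL : LargeCaps G lmax) (hc : IsRegular G lmax c)
    (hcap : ∀ v, lmax v ≤ L) (hst : t ≤ 2 * max 1 s ^ 2) (hs : SettledBelow G lmax s c)
    (τ : ℕ) :
    (law G lmax c τ).toOuterMeasure {c' | ¬ SettledBelow G lmax t c'} ≤
      ENNReal.ofReal (phaseFailure (Fintype.card V) L τ) := by
  set p := 500 * Real.exp (-(1 / 10 ^ 10)) ^ τ * 6 ^ L * (Fintype.card V : ℝ) ^ 2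
  set low : Finset V := {v | G.degree v < t}
  have hcover : {c' | ¬ SettledBelow G lmax t c'} ⊆ ⋃ v ∈ low, {c' | ¬ Settled G lmax c' v} := by
    intro c' h
    obtain ⟨v, hv, hn⟩ : ∃ v, G.degree v < t ∧ ¬ Settled G lmax c' v := by
      simpa [SettledBelow] using h
    exact Set.mem_biUnion (Finset.mem_filter.2 ⟨Finset.mem_univ v, hv⟩) hn
  calc (law G lmax c τ).toOuterMeasure {c' | ¬ SettledBelow G lmax t c'}
      ≤ ∑ v ∈ low, (law G lmax c τ).toOuterMeasure {c' | ¬ Settled G lmax c' v} :=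
        (MeasureTheory.measure_mono hcover).trans (MeasureTheory.measure_biUnion_finset_le _ _)
    _ ≤ low.card • ENNReal.ofReal p := Finset.sum_le_card_nsmul _ _ _ fun v hv =>
        toOuterMeasure_not_settled_le hL hc hcap hst hs (Finset.mem_filter.1 hv).2 τ
    _ ≤ Fintype.card V • ENNReal.ofReal p :=
        nsmul_le_nsmul_left zero_le (Finset.card_le_univ _)
    _ = _ := by
        rw [← ENNReal.ofReal_nsmul, nsmul_eq_mul, phaseFailure, pow_succ' _ 2, mul_left_comm]

/-- The degree threshold of the vertices that are settled after `i` phases. -/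
def phaseBound : ℕ → ℕ
  | 0 => 0
  | i + 1 => 2 ^ 2 ^ i

theorem phaseBound_succ_le (i : ℕ) : phaseBound (i + 1) ≤ 2 * max 1 (phaseBound i) ^ 2 := by
  rcases i with _ | i
  · simp [phaseBound]
  · calc phaseBound (i + 2) = phaseBound (i + 1) ^ 2 := by
          rw [phaseBound, phaseBound, ← pow_mul, pow_succ]
      _ ≤ max 1 (phaseBound (i + 1)) ^ 2 := Nat.pow_le_pow_left (le_max_right _ _) 2
      _ ≤ 2 * max 1 (phaseBound (i + 1)) ^ 2 := Nat.le_mul_of_pos_left _ two_pos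

theorem toOuterMeasure_phases_le (hL : LargeCaps G lmax) (hc : IsRegular G lmax c)
    (hcap : ∀ v, lmax v ≤ L) (τ i : ℕ) :
    (law G lmax c (i * τ)).toOuterMeasure {c' | ¬ SettledBelow G lmax (phaseBound i) c'} ≤
      i * ENNReal.ofReal (phaseFailure (Fintype.card V) L τ) := by
  induction i with
  | zero => simp [phaseBound, SettledBelow]
  | succ i ih =>
    rw [Nat.succ_mul, law_add, Nat.cast_succ, add_one_mul]
    refine (toOuterMeasure_bind_le _ _ fun c' hc' hs => ?_).trans (add_le_add_left ih _)
    exact toOuterMeasure_not_settledBelow_le hL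
      ((invariant_isRegular hL.one_lt).of_mem_support_law hL.pos hc hc') hcap
      (phaseBound_succ_le i) (not_not.1 hs) τ

theorem toOuterMeasure_exists_not_settled_le (hL : LargeCaps G lmax) (hc : IsConfig lmax c)
    (hcap : ∀ v, lmax v ≤ L) (τ : ℕ) {K : ℕ} (hK : Fintype.card V ≤ phaseBound K) :
    (law G lmax c (L + 1 + K * τ)).toOuterMeasure {c' | ¬ ∀ v, Settled G lmax c' v} ≤
      ENNReal.ofReal (K * phaseFailure (Fintype.card V) L τ) := by
  rw [law_add, ENNReal.ofReal_mul K.cast_nonneg, ENNReal.ofReal_natCast]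
  refine (toOuterMeasure_bind_le _ _ (s := ∅) fun c' hc' _ => ?_).trans_eq
    (by rw [MeasureTheory.measure_empty, zero_add])
  have hreg : IsRegular G lmax c' :=
    isRegular_of_mem_support_law hL.one_lt hc (fun v => Nat.lt_succ_of_le (hcap v)) hc'
  refine le_trans (MeasureTheory.measure_mono fun c₁ h => ?_)
    (toOuterMeasure_phases_le hL hreg hcap τ K)
  exact fun hs => h fun v => hs v ((G.degree_lt_card_verts v).trans_le hK)

theorem toOuterMeasure_not_stabilized_le (hL : LargeCaps G lmax) (hc : IsConfig lmax c)
    (hcap : ∀ v, lmax v ≤ L) {K τ T : ℕ} (hK : Fintype.card V ≤ phaseBound K)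
    (hT : L + 1 + K * τ < T) :
    (law G lmax c T).toOuterMeasure {c' | StabilizedToMIS G lmax c'}ᶜ ≤
      ENNReal.ofReal (K * phaseFailure (Fintype.card V) L τ) := by
  obtain ⟨r, rfl⟩ := Nat.exists_eq_add_of_lt hT
  rw [add_assoc, law_add]
  refine ((toOuterMeasure_bind_le _ _ (d := 0) fun c' _ hs => ?_).trans_eq (add_zero _)).trans
    (toOuterMeasure_exists_not_settled_le hL hc hcap τ hK)
  rw [nonpos_iff_eq_zero, PMF.toOuterMeasure_apply_eq_zero_iff,
    Set.disjoint_compl_right_iff_subset]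
  exact fun c₁ => stabilizedToMIS_of_mem_support_law hL.pos (not_not.1 hs)

end Phases

section Asymptotics

theorem largeCaps_of_logb {V : Type*} [Fintype V] {G : SimpleGraph V} [DecidableRel G.Adj]
    {lmax : V → ℕ} {c₁ : ℝ} (hc₁ : 30 ≤ c₁)
    (h : ∀ v, 2 * Real.logb 2 (G.degree v) + c₁ ≤ lmax v) : LargeCaps G lmax := by
  intro v
  have hv := h v
  have hlogb : 0 ≤ Real.logb 2 (G.degree v) := by
    rw [← Real.log_div_log]
    positivity
  have hcap : 30 ≤ lmax v := by exact_mod_cast (by linarith : (30 : ℝ) ≤ lmax v)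
  refine ⟨hcap, ?_⟩
  rcases (G.degree v).eq_zero_or_pos with hd | hd
  · simp [hd]
  · have hd' : (0 : ℝ) < G.degree v := by exact_mod_cast hd
    calc (G.degree v : ℝ) ^ 2 * 2 ^ 30
        = (2 : ℝ) ^ (Real.logb 2 (G.degree v) * (2 : ℕ) + (30 : ℕ)) := by
          rw [Real.rpow_add two_pos, Real.rpow_mul_natCast zero_le_two,
            Real.rpow_logb two_pos (by norm_num) hd', Real.rpow_natCast]
      _ ≤ (2 : ℝ) ^ (lmax v : ℝ) :=
          Real.rpow_le_rpow_of_exponent_le one_le_two (by push_cast; linarith)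
      _ = 2 ^ lmax v := Real.rpow_natCast _ _

theorem half_le_logb {x : ℝ} (hx : 3 / 2 ≤ x) : 1 / 2 ≤ Real.logb 2 x := by
  rw [Real.le_logb_iff_rpow_le one_lt_two (by linarith), ← Real.sqrt_eq_rpow,
    Real.sqrt_le_left (by linarith)]
  nlinarith

theorem three_halves_le_logb {x : ℝ} (hx : 3 ≤ x) : 3 / 2 ≤ Real.logb 2 x := by
  have hhalf : 1 / 2 ≤ Real.logb 2 (x / 2) := half_le_logb (by linarith)
  rw [Real.logb_div (by linarith) two_ne_zero, Real.logb_self_eq_one one_lt_two] at hhalf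
  linarith

theorem le_two_pow_ceil_logb {x : ℝ} (hx : 0 < x) : x ≤ (2 ^ ⌈Real.logb 2 x⌉₊ : ℕ) :=
  calc x = 2 ^ Real.logb 2 x := (Real.rpow_logb two_pos (by norm_num) hx).symm
    _ ≤ 2 ^ (⌈Real.logb 2 x⌉₊ : ℝ) :=
        Real.rpow_le_rpow_of_exponent_le one_le_two (Nat.le_ceil _)
    _ = (2 ^ ⌈Real.logb 2 x⌉₊ : ℕ) := by rw [Real.rpow_natCast]; norm_cast

theorem exists_phaseBound_ge {n : ℕ} (hn : 3 ≤ n) :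
    ∃ K : ℕ, n ≤ phaseBound K ∧ (K : ℝ) ≤ Real.logb 2 (Real.logb 2 n) + 2 := by
  have hl := three_halves_le_logb (x := n) (by exact_mod_cast hn)
  have hll := half_le_logb hl
  refine ⟨⌈Real.logb 2 (Real.logb 2 n)⌉₊ + 1, ?_, ?_⟩
  · have hexp : ⌈Real.logb 2 n⌉₊ ≤ 2 ^ ⌈Real.logb 2 (Real.logb 2 n)⌉₊ :=
      Nat.ceil_le.2 (le_two_pow_ceil_logb (by linarith))
    have hpow : n ≤ 2 ^ ⌈Real.logb 2 n⌉₊ := by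
      exact_mod_cast le_two_pow_ceil_logb (x := n) (by positivity)
    exact hpow.trans (Nat.pow_le_pow_right two_pos hexp)
  · push_cast
    linarith [Nat.ceil_lt_add_one (by linarith : 0 ≤ Real.logb 2 (Real.logb 2 n))]

theorem logb_two_le {x : ℝ} (hx : 0 < x) : Real.logb 2 x ≤ 2 * x := by
  rw [Real.logb, div_le_iff₀ (Real.log_pos one_lt_two)]
  nlinarith [Real.log_le_sub_one_of_pos hx, Real.log_two_gt_d9]

theorem log_le_logb_two {x : ℝ} (hx : 1 ≤ x) : Real.log x ≤ Real.logb 2 x :=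
  le_div_self (Real.log_nonneg hx) (Real.log_pos one_lt_two) (by linarith [Real.log_two_lt_d9])

theorem six_pow_le_rpow {x y : ℝ} {L : ℕ} (hx : 0 < x) (hL : (L : ℝ) ≤ y * Real.logb 2 x) :
    (6 : ℝ) ^ L ≤ x ^ (3 * y) :=
  calc (6 : ℝ) ^ L ≤ (2 ^ (3 : ℝ)) ^ L := by gcongr; norm_num
    _ = 2 ^ (3 * (L : ℝ)) := (Real.rpow_mul_natCast zero_le_two _ _).symm
    _ ≤ 2 ^ (Real.logb 2 x * (3 * y)) :=
        Real.rpow_le_rpow_of_exponent_le one_le_two (by linarith)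
    _ = x ^ (3 * y) := by
        rw [Real.rpow_mul zero_le_two, Real.rpow_logb two_pos (by norm_num) hx]

theorem exp_neg_pow_le_rpow {x y r : ℝ} {τ : ℕ} (hx : 1 ≤ x) (hy : 0 ≤ y)
    (hτ : y * Real.logb 2 x ≤ τ * r) : Real.exp (-r) ^ τ ≤ x ^ (-y) := by
  rw [← Real.exp_nat_mul, Real.rpow_def_of_pos (by linarith), Real.exp_le_exp]
  linarith [mul_le_mul_of_nonneg_left (log_le_logb_two hx) hy]

theorem mul_phaseFailure_le {n K L τ : ℕ} {c₂ a : ℝ} (hn : 3 ≤ n) (hc₂ : 0 ≤ c₂) (ha : 0 ≤ a)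
    (hK : (K : ℝ) ≤ Real.logb 2 (Real.logb 2 n) + 2) (hL : (L : ℝ) ≤ c₂ * Real.logb 2 n)
    (hτ : 10 ^ 10 * (12 + 3 * c₂ + a) * Real.logb 2 n ≤ τ) :
    K * phaseFailure n L τ ≤ (n : ℝ) ^ (-a) := by
  have hn3 : (3 : ℝ) ≤ n := by exact_mod_cast hn
  have hn0 : (0 : ℝ) < n := by linarith
  have hcube : (n : ℝ) ^ 3 = (n : ℝ) ^ (3 : ℝ) := by norm_cast
  have hK3 : (K : ℝ) ≤ (n : ℝ) ^ (3 : ℝ) := by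
    have hl := logb_two_le hn0
    have hll := logb_two_le (by linarith [three_halves_le_logb hn3] : 0 < Real.logb 2 (n : ℝ))
    rw [← hcube]
    nlinarith [pow_le_pow_left₀ zero_le_three hn3 2]
  have hfive : (500 : ℝ) ≤ (n : ℝ) ^ (6 : ℝ) := by
    calc (500 : ℝ) ≤ 3 ^ (6 : ℝ) := by norm_num
      _ ≤ (n : ℝ) ^ (6 : ℝ) := by gcongr
  have hsix := six_pow_le_rpow hn0 hL
  have hexp : Real.exp (-(1 / 10 ^ 10)) ^ τ ≤ (n : ℝ) ^ (-(12 + 3 * c₂ + a)) :=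
    exp_neg_pow_le_rpow (by linarith) (by linarith) (by linarith)
  calc K * phaseFailure n L τ
      ≤ (n : ℝ) ^ (3 : ℝ) * ((n : ℝ) ^ (6 : ℝ) * (n : ℝ) ^ (-(12 + 3 * c₂ + a)) *
          (n : ℝ) ^ (3 * c₂) * (n : ℝ) ^ (3 : ℝ)) := by
        rw [phaseFailure, hcube]
        gcongr
    _ = (n : ℝ) ^ (-a) := by
        simp only [← Real.rpow_add hn0]
        ring_nf

theorem rounds_le {c₂ M x : ℝ} {K : ℕ} (hc₂ : 0 ≤ c₂) (hM : 0 ≤ M) (hx : 3 / 2 ≤ x)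
    (hK : (K : ℝ) ≤ Real.logb 2 x + 2) :
    (⌊c₂ * x⌋₊ : ℝ) + 1 + K * ⌈M * x⌉₊ + 1 ≤
      (2 * c₂ + 5 * (M + 1) + 4) * (x * Real.logb 2 x) := by
  have hlog := half_le_logb hx
  have hfloor : (⌊c₂ * x⌋₊ : ℝ) ≤ c₂ * x := Nat.floor_le (by positivity)
  have hceil : (⌈M * x⌉₊ : ℝ) ≤ (M + 1) * x := by
    linarith [Nat.ceil_lt_add_one (by positivity : 0 ≤ M * x)]
  have hx_le : x ≤ 2 * (x * Real.logb 2 x) := by nlinarith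
  have hmul : (K : ℝ) * ⌈M * x⌉₊ ≤ 5 * Real.logb 2 x * ((M + 1) * x) := by
    gcongr
    linarith
  linarith [mul_le_mul_of_nonneg_left hx_le hc₂]

end Asymptotics

end BeepingMIS

/-- The logarithms are to base 2; an isolated vertex has `Real.logb 2 0 = 0`, that is, its cap is at
least `c₁`. The constant `C` depends only on `c₁`, `c₂` and the exponent `a` of the failure
probability `n ^ (-a)`, where `n = Fintype.card V`. -/
theorem theorem2 (c₁ c₂ a : ℝ) (hc₁ : 30 ≤ c₁) (hc₂ : 0 < c₂) (ha : 0 < a) :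
    ∃ C : ℝ, 0 < C ∧
      ∀ (V : Type*) [Fintype V] (G : SimpleGraph V) [DecidableRel G.Adj] (lmax : V → ℕ)
        (c : BeepingMIS.Config V) (T : ℕ),
        3 ≤ Fintype.card V →
        (∀ v, 2 * Real.logb 2 (G.degree v) + c₁ ≤ lmax v ∧
          lmax v ≤ c₂ * Real.logb 2 (Fintype.card V)) →
        BeepingMIS.IsConfig lmax c →
        C * (Real.logb 2 (Fintype.card V) * Real.logb 2 (Real.logb 2 (Fintype.card V))) ≤ T →
        1 - (Fintype.card V : ℝ) ^ (-a) ≤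
          ((BeepingMIS.law G lmax c T).toOuterMeasure
            {c' | BeepingMIS.StabilizedToMIS G lmax c'}).toReal := by
  set M := 10 ^ 10 * (12 + 3 * c₂ + a)
  refine ⟨2 * c₂ + 5 * (M + 1) + 4, by positivity, fun V _ G _ lmax c T hn hcap hc hT => ?_⟩
  set l := Real.logb 2 (Fintype.card V)
  have hl : 3 / 2 ≤ l := BeepingMIS.three_halves_le_logb (by exact_mod_cast hn)
  have hL : BeepingMIS.LargeCaps G lmax := BeepingMIS.largeCaps_of_logb hc₁ fun v => (hcap v).1
  have hfloor : ∀ v, lmax v ≤ ⌊c₂ * l⌋₊ := fun v => Nat.le_floor (hcap v).2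
  obtain ⟨K, hcard, hK⟩ := BeepingMIS.exists_phaseBound_ge hn
  have hrounds : ⌊c₂ * l⌋₊ + 1 + K * ⌈M * l⌉₊ < T := by
    exact_mod_cast (BeepingMIS.rounds_le hc₂.le (by positivity) hl hK).trans hT
  have hfail : K * BeepingMIS.phaseFailure (Fintype.card V) ⌊c₂ * l⌋₊ ⌈M * l⌉₊ ≤
      (Fintype.card V : ℝ) ^ (-a) :=
    BeepingMIS.mul_phaseFailure_le hn hc₂.le ha.le hK (Nat.floor_le (by positivity))
      (Nat.le_ceil _)
  exact BeepingMIS.one_sub_le_toReal_toOuterMeasure _ (by positivity)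
    ((BeepingMIS.toOuterMeasure_not_stabilized_le hL hc hfloor hcard hrounds).trans
      (ENNReal.ofReal_le_ofReal hfail))
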